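/- Let $n\ge 0$ and let $E$ be a finite-dimensional real vector space with a non-degenerate quadratic form $\mathbf q$ of signature $(2,n+1)$ and associated scalar product $\langle\cdot,\cdot\rangle$. Let $\mathbf H^{2,n}_+=\{x\in E: \mathbf q(x)=-1\}$, with the pseudo-Riemannian metric of signature $(2,n)$ induced by $\mathbf q$. Let $\mathbf P_+(E)=(E\setminus\{0\})/\mathbb R_{>0}$ be the space of rays, $\partial_\infty\mathbf H^{2,n}_+\subset \mathbf P_+(E)$ the set of isotropic rays, and $\overline{\mathbf H}{}^{2,n}_+=\mathbf H^{2,n}_+\cup\partial_\infty\mathbf H^{2,n}_+\subset\mathbf P_+(E)$. A pair of points of $\mathbf H^{2,n}_+$ is acausal if the geodesic through them is spacelike, that is, if they span a subspace of signature $(1,1)$; a surface is acausal if it is spacelike and any two distinct points of it form an acausal pair. A pointed hyperbolic plane $\mathsf P=(q,H)$ is given by a point $q\in\mathbf H^{2,n}_+$ and a positive definite $2$-plane $U\subset q^\perp$; $H$ is the connected component containing $q$ of $(\mathbb Rq\oplus U)\cap\mathbf H^{2,n}_+$. Let $W=U^\perp$, let $\mathbf D\subset U$ be the open unit disk and $\mathbf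 S^n\subset W$ the unit sphere of $-\mathbf q$. The map $$\Psi(u,w)=\frac{2}{1-\mathbf q(u)}\,u+\frac{1+\mathbf q(u)}{1-\mathbf q(u)}\,w$$ is a diffeomorphism $\mathbf D\times \mathbf S^n\to\mathbf H^{2,n}_+$, and the warped projection $\pi_{\mathsf P}:\mathbf H^{2,n}_+\to H$ is defined by $\pi_{\mathsf P}(\Psi(u,w))=\Psi(u,q)$. A timelike sphere is a set of the form $\pi_{\mathsf P}^{-1}(q)$ for some pointed hyperbolic plane $\mathsf P=(q,H)$. Let $S$ be a simply connected (in particular connected) smooth surface without boundary with a smooth spacelike immersion into $\mathbf H^{2,n}_+$ (i.e. the induced metric on $S$ is Riemannian). Say that $S$ is an entire graph if for every pointed hyperbolic plane $\mathsf P=(q,H)$ the restriction of $\pi_{\mathsf P}$ to $S$ is a diffeomorphism onto $H$. The asymptotic boundary $\partial_\infty S$ is the intersection with $\partial_\infty\mathbf H^{2,n}_+$ of the total boundary $\overline S\setminus S$, where $\overline S$ is the closure of $S$ in $\overline{\mathbf H}{}^{2,n}_+$. A semi-positive loop is a subset of $\overline{\mathbf H}{}^{2,n}_+$ homeomorphic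 to a circle that contains no triple of pairwise distinct points spanning a subspace of signature $(1,2)$, and contains at least one triple of pairwise distinct points spanning a subspace of signature $(2,1)$. Then: 1. If $S$ is properly immersed, or if its induced metric is complete, then $S$ is an entire graph. 2. If $S$ is an entire graph, then it is acausal. 3. If $S$ is an entire graph, then it intersects every timelike sphere exactly once. 4. If $S$ is an entire graph, then $\partial_\infty S$ is a semi-positive loop. -/

import Mathlib

open scoped Manifold ContDiff Topology

noncomputable section

namespace PseudoHyperbolic

variable {E : Type*} [NormedAddCommGroup E] [NormedSpace ℝ E]

/-! ### Signatures and the pseudo-hyperbolic space -/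

/-- The restriction of `Q` to the subspace `F` is non-degenerate of signature `(p, q)`. -/
def HasSignature (Q : QuadraticForm ℝ E) (F : Submodule ℝ E) (p q : ℕ) : Prop :=
  Module.finrank ℝ F = p + q ∧
    sigPos (Q.restrict F) = p ∧ sigNeg (Q.restrict F) = q

/-- The symmetric bilinear form `⟨x, y⟩` with `⟨x, x⟩ = Q x`. -/
def scal (Q : QuadraticForm ℝ E) : LinearMap.BilinForm ℝ E := QuadraticMap.associated Q

/-- The (double cover of the) pseudo-hyperbolic space, `{x ∈ E | Q x = -1}`. -/
def PseudoHyp (Q : QuadraticForm ℝ E) : Set E := {x | Q x = -1}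

/-- Two points of the pseudo-hyperbolic space form an acausal pair if the geodesic through them is
spacelike, i.e. if they span a subspace of signature `(1, 1)`. -/
def IsAcausalPair (Q : QuadraticForm ℝ E) (x y : PseudoHyp Q) : Prop :=
  HasSignature Q (Submodule.span ℝ {(x : E), (y : E)}) 1 1

/-- A subset is acausal if any two distinct points of it form an acausal pair. -/
def IsAcausalSet (Q : QuadraticForm ℝ E) (A : Set (PseudoHyp Q)) : Prop :=
  ∀ x ∈ A, ∀ y ∈ A, x ≠ y → IsAcausalPair Q x y

/-! ### Pointed hyperbolic planes and the warped projection -/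

/-- A pointed hyperbolic plane `(q, H)`, given by the corresponding orthogonal splitting
`E = ℝ q ⊕ U ⊕ V`, where `Q q = -1` and `U` is a positive definite plane. -/
structure PointedPlane (Q : QuadraticForm ℝ E) where
  q : E
  U : Submodule ℝ E
  q_mem : q ∈ PseudoHyp Q
  finrank_U : Module.finrank ℝ U = 2
  posDef_U : (Q.restrict U).PosDef
  ortho : ∀ u ∈ U, scal Q q u = 0

namespace PointedPlane

variable {Q : QuadraticForm ℝ E} (P : PointedPlane Q)

/-- The hyperbolic plane `H`: the sheet containing `q` of the two-sheeted hyperboloid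
`(ℝ q ⊕ U) ∩ {Q = -1}`. -/
def plane : Set E :=
  {x | x ∈ PseudoHyp Q ∧ x ∈ Submodule.span ℝ {P.q} ⊔ P.U ∧ scal Q x P.q < 0}

/-- The orthogonal complement `W = ℝ q ⊕ V` of `U`. -/
def W : Submodule ℝ E := (scal Q).orthogonal P.U

theorem nonneg_of_mem_U {u : E} (hu : u ∈ P.U) : 0 ≤ Q u :=
  P.posDef_U.nonneg ⟨u, hu⟩

variable [FiniteDimensional ℝ E]

theorem isCompl : IsCompl P.U P.W := by
  have hs : (scal Q).IsSymm := ⟨QuadraticMap.associated_isSymm ℝ Q⟩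
  refine LinearMap.BilinForm.isCompl_orthogonal_of_restrict_nondegenerate hs.isRefl ?_
  have hself : ∀ x : P.U, ((scal Q).restrict P.U) x x = Q.restrict P.U x := by
    intro x
    simp [scal, QuadraticMap.associated_eq_self_apply]
  refine ⟨fun x hx => ?_, fun x hx => ?_⟩ <;>
  · by_contra hne
    have := P.posDef_U x hne
    rw [← hself, hx x] at this
    exact lt_irrefl _ this

/-- The orthogonal projection of `E = U ⊕ W` onto `U`. -/
def projU : E →ₗ[ℝ] E := P.U.projection P.W P.isCompl

/-- The warped diffeomorphism `Ψ`, on the product of the open unit disk of `U` and the unit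
sphere of `W` (for `-Q`). -/
def warp (u w : E) : E :=
  (2 / (1 - Q u)) • u + ((1 + Q u) / (1 - Q u)) • w

/-- The first coordinate of the inverse of `Ψ`. -/
def diskCoord (x : E) : E := (1 + √(1 + Q (P.projU x)))⁻¹ • P.projU x

/-- The second coordinate of the inverse of `Ψ`. -/
def sphereCoord (x : E) : E := (√(1 + Q (P.projU x)))⁻¹ • (x - P.projU x)

/-- The warped projection, `Ψ (u, w) ↦ Ψ (u, q)`. -/
def warpedProj (x : E) : E := warp (Q := Q) (P.diskCoord x) P.q

theorem projU_mem (x : E) : P.projU x ∈ P.U := Submodule.projection_apply_mem P.isCompl x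

theorem diskCoord_warp {u w : E} (hu : u ∈ P.U) (hu1 : Q u < 1) (hw : w ∈ P.W) :
    P.diskCoord (warp (Q := Q) u w) = u := by
  have h0 := P.nonneg_of_mem_U hu
  have h1 : 0 < 1 - Q u := by linarith
  have hp : P.projU (warp (Q := Q) u w) = (2 / (1 - Q u)) • u := by
    simp only [warp, projU, map_add, map_smul]
    rw [(Submodule.projection_apply_eq_zero_iff P.isCompl).2 hw,
      (Submodule.projection_eq_self_iff P.isCompl u).2 hu]
    simp
  have hs : √(1 + Q (P.projU (warp (Q := Q) u w))) = (1 + Q u) / (1 - Q u) := by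
    rw [hp, QuadraticMap.map_smul, Real.sqrt_eq_iff_mul_self_eq (by positivity) (by positivity)]
    simp only [smul_eq_mul]
    field_simp
    ring
  rw [diskCoord, hs, hp, smul_smul]
  have : (1 + (1 + Q u) / (1 - Q u))⁻¹ * (2 / (1 - Q u)) = 1 := by
    field_simp
    ring
  rw [this, one_smul]

/-- The coordinates `diskCoord`, `sphereCoord` do invert `Ψ` on the pseudo-hyperbolic space. -/
theorem warp_coord (x : E) :
    warp (Q := Q) (P.diskCoord x) (P.sphereCoord x) = x := by
  have h0 := P.nonneg_of_mem_U (P.projU_mem x)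
  set a := Q (P.projU x) with ha
  set s := √(1 + a) with hs
  have hs2 : s * s = 1 + a := Real.mul_self_sqrt (by positivity)
  have hs0 : 0 < s := Real.sqrt_pos.2 (by positivity)
  have hr : Q (P.diskCoord x) = (s - 1) / (1 + s) := by
    rw [diskCoord, QuadraticMap.map_smul, ← ha, ← hs]
    have : a = (s - 1) * (s + 1) := by linarith
    rw [this]
    simp only [smul_eq_mul]
    field_simp
    ring
  have h1 : 1 - (s - 1) / (1 + s) = 2 / (1 + s) := by field_simp; ring
  have h2 : 1 + (s - 1) / (1 + s) = 2 * s / (1 + s) := by field_simp; ring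
  rw [warp, hr, h1, h2, diskCoord, sphereCoord, ← ha, ← hs, smul_smul, smul_smul]
  have e1 : 2 / (2 / (1 + s)) * (1 + s)⁻¹ = 1 := by field_simp
  have e2 : 2 * s / (1 + s) / (2 / (1 + s)) * s⁻¹ = 1 := by field_simp
  rw [e1, e2]
  module

end PointedPlane

variable [FiniteDimensional ℝ E]

/-- A timelike sphere: a fiber of the warped projection of some pointed hyperbolic plane `(q, H)`
above the base point `q`. -/
def IsTimelikeSphere (Q : QuadraticForm ℝ E) (A : Set (PseudoHyp Q)) : Prop :=
  ∃ P : PointedPlane Q, A = {x : PseudoHyp Q | P.warpedProj (x : E) = P.q}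

/-! ### The compactification and semi-positive loops -/

/-- The quotient topology on the space of rays of `E`. -/
instance rayTopology : TopologicalSpace (Module.Ray ℝ E) :=
  TopologicalSpace.coinduced (fun v : {v : E // v ≠ 0} => rayOfNeZero ℝ v.1 v.2) inferInstance

/-- The ray spanned by a point of the pseudo-hyperbolic space. -/
def toRay (Q : QuadraticForm ℝ E) (x : PseudoHyp Q) : Module.Ray ℝ E :=
  rayOfNeZero ℝ (x : E) (by
    intro h
    have hx : Q (x : E) = -1 := x.2
    rw [h, QuadraticMap.map_zero] at hx
    norm_num at hx)

/-- The boundary at infinity: the set of isotropic rays. -/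
def infinity (Q : QuadraticForm ℝ E) : Set (Module.Ray ℝ E) :=
  {r | ∃ (v : E) (hv : v ≠ 0), Q v = 0 ∧ r = rayOfNeZero ℝ v hv}

/-- The compactification of the pseudo-hyperbolic space, inside the space of rays. -/
def compactification (Q : QuadraticForm ℝ E) : Set (Module.Ray ℝ E) :=
  Set.range (toRay Q) ∪ infinity Q

/-- The linear span of a set of rays. -/
def raySpan (A : Set (Module.Ray ℝ E)) : Submodule ℝ E :=
  Submodule.span ℝ {v | ∃ hv : v ≠ 0, rayOfNeZero ℝ v hv ∈ A}

/-- A triple of pairwise distinct points is positive if it spans a space of signature `(2, 1)`. -/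
def IsPositiveTriple (Q : QuadraticForm ℝ E) (a b c : Module.Ray ℝ E) : Prop :=
  a ≠ b ∧ a ≠ c ∧ b ≠ c ∧ HasSignature Q (raySpan {a, b, c}) 2 1

/-- A triple of pairwise distinct points is negative if it spans a space of signature `(1, 2)`. -/
def IsNegativeTriple (Q : QuadraticForm ℝ E) (a b c : Module.Ray ℝ E) : Prop :=
  a ≠ b ∧ a ≠ c ∧ b ≠ c ∧ HasSignature Q (raySpan {a, b, c}) 1 2

/-- A semi-positive loop: a topological circle in the compactification which contains no negative
triple and at least one positive triple. -/
def IsSemiPositiveLoop (Q : QuadraticForm ℝ E) (L : Set (Module.Ray ℝ E)) : Prop :=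
  L ⊆ compactification Q ∧ Nonempty (L ≃ₜ Circle) ∧
    (¬ ∃ a ∈ L, ∃ b ∈ L, ∃ c ∈ L, IsNegativeTriple Q a b c) ∧
    ∃ a ∈ L, ∃ b ∈ L, ∃ c ∈ L, IsPositiveTriple Q a b c

/-- The total boundary of (the image `A` of) a surface without boundary: its closure in the
compactification, minus the surface itself. -/
def totalBoundary (Q : QuadraticForm ℝ E) (A : Set (PseudoHyp Q)) : Set (Module.Ray ℝ E) :=
  (closure (toRay Q '' A) ∩ compactification Q) \ (toRay Q '' A)

/-- The asymptotic boundary: the part of the total boundary lying at infinity. -/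
def asymptoticBoundary (Q : QuadraticForm ℝ E) (A : Set (PseudoHyp Q)) :
    Set (Module.Ray ℝ E) :=
  totalBoundary Q A ∩ infinity Q

/-! ### Spacelike surfaces -/

section Surface

variable {S : Type*} [TopologicalSpace S] [ChartedSpace (EuclideanSpace ℝ (Fin 2)) S]

/-- The first fundamental form `v ↦ Q (df_s v)` of a map `f` from a surface to the
pseudo-hyperbolic space. -/
def firstForm (Q : QuadraticForm ℝ E) (f : S → PseudoHyp Q) (s : S)
    (v : TangentSpace (𝓡 2) s) : ℝ :=
  Q (mfderiv (𝓡 2) 𝓘(ℝ, E) (fun t => (f t : E)) s v : E)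

/-- A smooth map from a surface to the pseudo-hyperbolic space whose first fundamental form is
positive definite (so that it is an immersion, with spacelike image). -/
def IsSpacelikeImmersion (Q : QuadraticForm ℝ E) (f : S → PseudoHyp Q) : Prop :=
  ContMDiff (𝓡 2) 𝓘(ℝ, E) ∞ (fun s => (f s : E)) ∧
    ∀ (s : S) (v : TangentSpace (𝓡 2) s), v ≠ 0 → 0 < firstForm Q f s v

/-- The distance of the metric induced on the surface: the infimum of the lengths of `C^1` paths,
where the length of a tangent vector is the square root of the first fundamental form. -/
def inducedEDist (Q : QuadraticForm ℝ E) (f : S → PseudoHyp Q) (x y : S) : ENNReal :=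
  letI : ∀ s : S, ENorm (TangentSpace (𝓡 2) s) :=
    fun s => ⟨fun v => ENNReal.ofReal √(firstForm Q f s v)⟩
  Manifold.riemannianEDist (𝓡 2) x y

/-- The induced metric is complete: every Cauchy sequence converges. -/
def IsCompleteInduced (Q : QuadraticForm ℝ E) (f : S → PseudoHyp Q) : Prop :=
  ∀ a : ℕ → S,
    (∀ ε : ENNReal, 0 < ε → ∃ N, ∀ k ≥ N, ∀ l ≥ N, inducedEDist Q f (a k) (a l) < ε) →
    ∃ x : S, Filter.Tendsto (fun k => inducedEDist Q f (a k) x) Filter.atTop (𝓝 0)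

/-- `φ` is a diffeomorphism of the surface `S` onto the embedded submanifold `N` of `E`. -/
def IsDiffeoOnto (φ : S → E) (N : Set E) : Prop :=
  ContMDiff (𝓡 2) 𝓘(ℝ, E) ∞ φ ∧ (∀ s, φ s ∈ N) ∧
    ∃ ψ : E → S, ContMDiffOn 𝓘(ℝ, E) (𝓡 2) ∞ ψ N ∧ (∀ s, ψ (φ s) = s) ∧
      ∀ x ∈ N, φ (ψ x) = x

/-- The surface is an entire graph: for every pointed hyperbolic plane `(q, H)`, the warped
projection restricts to a diffeomorphism of the surface onto `H`. -/
def IsEntireGraph (Q : QuadraticForm ℝ E) (f : S → PseudoHyp Q) : Prop :=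
  ∀ P : PointedPlane Q, IsDiffeoOnto (fun s => P.warpedProj (f s : E)) P.plane

end Surface

end PseudoHyperbolic

end

/-!
A splitting of `E` as the sum of a positive definite plane `U` and its orthogonal `W` writes the
warped projection of a point as a function of its component in `U`. The surface is thus an entire
graph as soon as its linear projections onto all such planes `U` are diffeomorphisms.

**Entire graphs.** The projection of a spacelike surface to `U` is a local diffeomorphism which
does not decrease the form. Hence a partial lift of a segment of `U` has finite length and stays in
a compact subset of the quadric, so that it has a limit when the surface is complete or properly
immersed: every segment lifts. A local homeomorphism from a connected space to a vector space along
which segments lift is bijective.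

**Acausality.** Let `x ≠ y` be points of an entire graph. If `⟨x, y⟩ ^ 2 < 1`, they span a negative
definite plane, and the projection to a positive definite plane orthogonal to it identifies them. If
`⟨x, y⟩ ^ 2 = 1`, then `x` minimizes `⟨·, y⟩ ^ 2` on the surface, and the projection to the tangent
plane at `x` identifies them. Thus `1 < ⟨x, y⟩ ^ 2`, and by connectedness `⟨x, y⟩ ≤ -1` throughout.

**Boundary.** Rescaled into the product of the unit disk and the unit sphere, the surface has for
closure a graph over the closed disk, whose isotropic part is a graph `z ↦ c z` over the circle with
nonpositive products, so without negative triple. If it had no positive triple, nearby points would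
be orthogonal, since each has negative product with the antipode of the other; three such points are
linearly dependent, which gives `c (z ζ⁻¹) + c (z ζ) = 2 Re ζ • c z` for `ζ` close to `1`. The
nonnegative function `z ↦ -⟨c z, x⟩`, with `x` on the surface, would inherit this relation, and
vanish by a minimum principle. But for each `z` it is positive for a suitable `x`.
-/

noncomputable section

namespace PseudoHyperbolic

/-! ### Local homeomorphisms onto a vector space along which segments lift -/

section Lifting

open Set Filter

theorem bijective_of_continuous_rightInverse {X Y : Type*} [TopologicalSpace X]
    [TopologicalSpace Y] [T2Space X] [PreconnectedSpace X] [Nonempty Y] {φ : X → Y}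
    (hφ : IsLocalHomeomorph φ) {σ : Y → X} (hσ : Continuous σ) (h : Function.RightInverse σ φ) :
    Function.Bijective φ := by
  have hopen : IsOpen (range σ) := by
    refine (hφ.isOpenEmbedding_of_comp ?_ hσ).isOpen_range
    rw [h.comp_eq_id]
    exact Topology.IsOpenEmbedding.id
  have hclosed : IsClosed (range σ) := h.leftInverse.isClosed_range hφ.continuous hσ
  have huniv : range σ = univ := IsClopen.eq_univ ⟨hclosed, hopen⟩ (range_nonempty σ)
  exact ⟨(h.leftInverse.rightInverse_of_surjective (range_eq_univ.1 huniv)).injective,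
    h.surjective⟩

variable {X V : Type*} [TopologicalSpace X] [NormedAddCommGroup V] [NormedSpace ℝ V]
  {φ : X → V} {x : X} {v : V} {g : ℝ → X}

/-- `g` lifts the segment `t ↦ φ x + t v` through `φ`, starting from `x`, for the parameters in
`A`. -/
structure IsLiftOn (φ : X → V) (x : X) (v : V) (A : Set ℝ) (g : ℝ → X) : Prop where
  continuousOn : ContinuousOn g A
  zero : g 0 = x
  lift : ∀ t ∈ A, φ (g t) = φ x + t • v

namespace IsLiftOn

theorem mono {A B : Set ℝ} (h : IsLiftOn φ x v A g) (hBA : B ⊆ A) : IsLiftOn φ x v B g :=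
  ⟨h.continuousOn.mono hBA, h.zero, fun t ht => h.lift t (hBA ht)⟩

theorem eqOn [T2Space X] (hφ : IsLocalHomeomorph φ) {T : ℝ} (hT : 0 ≤ T) {g' : ℝ → X}
    (h : IsLiftOn φ x v (Icc 0 T) g) (h' : IsLiftOn φ x v (Icc 0 T) g') :
    EqOn g g' (Icc 0 T) :=
  (T2Space.isSeparatedMap φ).eqOn_of_comp_eqOn hφ.isLocallyInjective isPreconnected_Icc
    h.continuousOn h'.continuousOn (fun t ht => (h.lift t ht).trans (h'.lift t ht).symm)
    (left_mem_Icc.2 hT) (h.zero.trans h'.zero.symm)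

theorem exists_extend {t₁ t₂ : ℝ} (h0 : 0 ≤ t₁) (h12 : t₁ ≤ t₂)
    (h : IsLiftOn φ x v (Icc 0 t₁) g) (e : OpenPartialHomeomorph X V) (he : φ = e)
    (hg : g t₁ ∈ e.source) (hseg : ∀ t ∈ Icc t₁ t₂, φ x + t • v ∈ e.target) :
    ∃ g', IsLiftOn φ x v (Icc 0 t₂) g' := by
  classical
  have hjoin : e.symm (φ x + t₁ • v) = g t₁ := by
    rw [← h.lift t₁ ⟨h0, le_rfl⟩, he, e.left_inv hg]
  have hcont : ContinuousOn (fun t : ℝ => e.symm (φ x + t • v)) (Icc t₁ t₂) :=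
    e.continuousOn_symm.comp (by fun_prop) hseg
  refine ⟨fun t => if t ≤ t₁ then g t else e.symm (φ x + t • v), ?_, ?_, fun t ht => ?_⟩
  · rw [← Icc_union_Icc_eq_Icc h0 h12]
    refine ContinuousOn.union_of_isClosed (h.continuousOn.congr fun t ht => if_pos ht.2)
      (hcont.congr fun t ht => ?_) isClosed_Icc isClosed_Icc
    rcases ht.1.eq_or_lt with rfl | hlt
    · simp only [le_refl, if_true, hjoin]
    · exact if_neg hlt.not_ge
  · simp only [h0, if_true, h.zero]
  · by_cases htt : t ≤ t₁
    · simp only [htt, if_true]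
      exact h.lift t ⟨ht.1, htt⟩
    · simp only [htt, if_false]
      have hmem := hseg t ⟨(not_le.1 htt).le, ht.2⟩
      nth_rw 1 [he]
      rw [e.right_inv hmem]

theorem exists_extend_near (hφ : IsLocalHomeomorph φ) {T : ℝ} {y : X} (hy : φ y = φ x + T • v) :
    ∃ U ∈ 𝓝 y, ∃ δ > 0, ∀ t₁ t₂, 0 ≤ t₁ → t₁ ≤ t₂ → T - δ < t₁ → t₂ < T + δ →
      ∀ g, IsLiftOn φ x v (Icc 0 t₁) g → g t₁ ∈ U → ∃ g', IsLiftOn φ x v (Icc 0 t₂) g' := by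
  obtain ⟨e, hye, he⟩ := hφ y
  have hmem : φ x + T • v ∈ e.target := by
    rw [← hy, he]
    exact e.map_source hye
  have hcont : Continuous fun t : ℝ => φ x + t • v := by fun_prop
  obtain ⟨δ, hδ, hball⟩ := Metric.mem_nhds_iff.1
    (hcont.continuousAt.preimage_mem_nhds (e.open_target.mem_nhds hmem))
  refine ⟨e.source, e.open_source.mem_nhds hye, δ, hδ, ?_⟩
  intro t₁ t₂ h0 h12 h1 h2 g hg hge
  refine hg.exists_extend h0 h12 e he hge fun t ht => hball ?_
  rw [Metric.mem_ball, Real.dist_eq, abs_lt]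
  constructor <;> linarith [ht.1, ht.2]

theorem exists_Ico [T2Space X] (hφ : IsLocalHomeomorph φ) {T : ℝ} (hT : 0 < T)
    (h : ∀ t ∈ Ico 0 T, ∃ g, IsLiftOn φ x v (Icc 0 t) g) : ∃ g, IsLiftOn φ x v (Ico 0 T) g := by
  have : Nonempty X := ⟨x⟩
  choose! L hL using h
  have heq {t t' : ℝ} (ht : t ∈ Ico 0 T) (ht' : t' ∈ Ico 0 T) (htt' : t ≤ t') :
      L t t = L t' t :=
    (hL t ht).eqOn hφ ht.1 ((hL t' ht').mono (Icc_subset_Icc_right htt')) ⟨ht.1, le_rfl⟩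
  refine ⟨fun t => L t t, fun t ht => ?_, (hL 0 ⟨le_rfl, hT⟩).zero,
    fun t ht => (hL t ht).lift t ⟨ht.1, le_rfl⟩⟩
  obtain ⟨t', htt', ht'T⟩ := exists_between ht.2
  have ht' : t' ∈ Ico 0 T := ⟨ht.1.trans htt'.le, ht'T⟩
  have hnear : ∀ᶠ r in 𝓝[Ico 0 T] t, r ∈ Ico 0 T ∧ r ≤ t' :=
    eventually_mem_nhdsWithin.and
      (mem_nhdsWithin_of_mem_nhds (Iic_mem_nhds htt'))
  have hcont : ContinuousWithinAt (L t') (Ico 0 T) t :=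
    ((hL t' ht').continuousOn t ⟨ht.1, htt'.le⟩).mono_of_mem_nhdsWithin <| by
      filter_upwards [hnear] with r hr using ⟨hr.1.1, hr.2⟩
  refine hcont.congr_of_eventuallyEq ?_ (heq ht ht' htt'.le)
  filter_upwards [hnear] with r hr using heq hr.1 ht' hr.2

theorem eq_of_mapClusterPt (hφ : Continuous φ) {T : ℝ} (hT : 0 < T)
    (hg : IsLiftOn φ x v (Ico 0 T) g) {y : X} (hy : MapClusterPt y (𝓝[<] T) g) :
    φ y = φ x + T • v := by
  have hlim : Tendsto (φ ∘ g) (𝓝[<] T) (𝓝 (φ x + T • v)) := by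
    have hcont : Continuous fun t : ℝ => φ x + t • v := by fun_prop
    refine (hcont.tendsto' T _ rfl |>.mono_left nhdsWithin_le_nhds).congr' ?_
    filter_upwards [Ico_mem_nhdsLT hT] with t ht using (hg.lift t ht).symm
  have hcluster : MapClusterPt (φ y) (𝓝[<] T) (φ ∘ g) :=
    hy.continuousAt_comp hφ.continuousAt
  exact eq_of_nhds_neBot (NeBot.mono hcluster (inf_le_inf le_rfl hlim))

end IsLiftOn

/-- Continuous induction on the parameter: the lift extends past every parameter it reaches, and
to the endpoint of every half-open interval by taking a cluster point. -/
theorem exists_isLiftOn [T2Space X] (hφ : IsLocalHomeomorph φ)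
    (h : ∀ T ∈ Ioc 0 1, ∀ g, IsLiftOn φ x v (Ico 0 T) g → ∃ y, MapClusterPt y (𝓝[<] T) g) :
    ∃ g, IsLiftOn φ x v (Icc 0 1) g := by
  let A : Set ℝ := {T | ∃ g, IsLiftOn φ x v (Icc 0 T) g}
  have hdown {t t' : ℝ} (htt' : t ≤ t') (ht' : t' ∈ A) : t ∈ A :=
    ht'.imp fun g hg => hg.mono (Icc_subset_Icc_right htt')
  have hzero : (0 : ℝ) ∈ A := by
    refine ⟨fun _ => x, continuousOn_const, rfl, fun t ht => ?_⟩
    rw [le_antisymm ht.2 ht.1, zero_smul, add_zero]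
  have hlimit (T : ℝ) (hT : T ∈ Ioc 0 1) (hlt : ∀ t < T, t ∈ A) : T ∈ A := by
    obtain ⟨g, hg⟩ := IsLiftOn.exists_Ico hφ hT.1 fun t ht => hlt t ht.2
    obtain ⟨y, hy⟩ := h T hT g hg
    obtain ⟨U, hU, δ, hδ, hext⟩ :=
      IsLiftOn.exists_extend_near hφ (hg.eq_of_mapClusterPt hφ.continuous hT.1 hy)
    have hmem : Ico 0 T ∩ Ioo (T - δ) T ∈ 𝓝[<] T :=
      inter_mem (Ico_mem_nhdsLT hT.1) (Ioo_mem_nhdsLT (by linarith))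
    obtain ⟨t, htU, ht, htδ⟩ := ((hy.frequently hU).and_eventually hmem).exists
    exact hext t T ht.1 ht.2.le htδ.1 (by linarith) g
      (hg.mono (Icc_subset_Ico_right ht.2)) htU
  have hclosed : IsClosed (A ∩ Icc 0 1) := by
    refine isClosed_of_closure_subset fun T hT => ?_
    have hT01 : T ∈ Icc 0 1 := isClosed_Icc.closure_subset_iff.2 inter_subset_right hT
    refine ⟨?_, hT01⟩
    rcases hT01.1.eq_or_lt with rfl | hpos
    · exact hzero
    · refine hlimit T ⟨hpos, hT01.2⟩ fun t ht => ?_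
      obtain ⟨t', htt', ht', -⟩ := mem_closure_iff.1 hT _ isOpen_Ioi ht
      exact hdown (le_of_lt htt') ht'
  refine hclosed.Icc_subset_of_forall_exists_gt hzero ?_ ⟨zero_le_one, le_rfl⟩
  rintro T ⟨⟨g, hg⟩, hT⟩ T' (hTT' : T < T')
  obtain ⟨U, hU, δ, hδ, hext⟩ := IsLiftOn.exists_extend_near hφ (hg.lift T ⟨hT.1, le_rfl⟩)
  obtain ⟨t, htT, ht⟩ := exists_between (lt_min hTT' (lt_add_of_pos_right T hδ))
  rw [lt_min_iff] at ht
  exact ⟨t, hext T t hT.1 htT.le (by linarith) ht.2 g hg (mem_of_mem_nhds hU), htT, ht.1.le⟩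

theorem bijective_of_lifts [T2Space X] [ConnectedSpace X] (hφ : IsLocalHomeomorph φ)
    (h : ∀ (x : X) (v : V), ∀ T ∈ Ioc (0 : ℝ) 1, ∀ g, IsLiftOn φ x v (Ico 0 T) g →
      ∃ y, MapClusterPt y (𝓝[<] T) g) :
    Function.Bijective φ := by
  obtain ⟨x⟩ : Nonempty X := inferInstance
  choose g hg using fun v : V => exists_isLiftOn hφ (h x (v - φ x))
  let G : unitInterval × V → X := fun p => g p.2 p.1
  have hG : Continuous G := by
    let F : C(unitInterval × V, V) := ⟨fun p => φ x + (p.1 : ℝ) • (p.2 - φ x), by fun_prop⟩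
    refine hφ.continuous_lift (T2Space.isSeparatedMap φ) F ?_ ?_ fun v =>
      (hg v).continuousOn.comp_continuous continuous_subtype_val fun t => t.2
    · funext p
      exact (hg p.2).lift p.1 p.1.2
    · rw [show (fun v => G (0, v)) = fun _ => x from funext fun v => (hg v).zero]
      exact continuous_const
  refine bijective_of_continuous_rightInverse hφ (σ := fun v => G (1, v))
    (hG.comp (by fun_prop)) fun v => ?_
  have := (hg v).lift 1 (by simp)
  rwa [one_smul, add_sub_cancel] at this

end Lifting

/-! ### A minimum principle on the circle -/

section Circle

open Set Topology

theorem exists_re_lt_one_of_eventually {p : Circle → Prop} (h : ∀ᶠ ζ in 𝓝 1, p ζ) :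
    ∃ ζ : Circle, (ζ : ℂ).re < 1 ∧ p ζ := by
  have hexp : Filter.Tendsto Circle.exp (𝓝[>] 0) (𝓝 1) := by
    simpa using (Circle.exp.continuous.tendsto 0).mono_left nhdsWithin_le_nhds
  obtain ⟨δ, hp, hδ⟩ := ((hexp.eventually h).and (Ioo_mem_nhdsGT Real.pi_pos)).exists
  refine ⟨Circle.exp δ, ?_, hp⟩
  rw [Circle.coe_exp, Complex.exp_ofReal_mul_I_re]
  exact (Real.cos_lt_cos_of_nonneg_of_le_pi le_rfl hδ.2.le hδ.1).trans_eq Real.cos_zero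

/-- Locally such a function is a combination of `cos` and `sin`, and no nonzero one is nonnegative
on the circle: a minimum is a zero, and the set of zeros is open. -/
theorem eq_zero_of_add_eq_re_mul {φ : Circle → ℝ} (hφ : Continuous φ) (hnonneg : ∀ z, 0 ≤ φ z)
    (h : ∀ᶠ ζ : Circle in 𝓝 1, ∀ z, φ (z * ζ⁻¹) + φ (z * ζ) = 2 * (ζ : ℂ).re * φ z) (z : Circle) :
    φ z = 0 := by
  have hzero : IsClopen {z | φ z = 0} := by
    refine ⟨isClosed_eq hφ continuous_const, isOpen_iff_mem_nhds.2 fun z hz => ?_⟩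
    have hlim : Filter.Tendsto (fun y => z⁻¹ * y) (𝓝 z) (𝓝 1) := by
      simpa using (continuous_const_mul z⁻¹).tendsto z
    filter_upwards [hlim.eventually h] with y hy
    have hsum := hy z
    rw [mul_inv_cancel_left, show φ z = 0 from hz] at hsum
    change φ y = 0
    linarith [hnonneg (z * (z⁻¹ * y)⁻¹), hnonneg y]
  have hmin : ∃ z, φ z = 0 := by
    obtain ⟨z, -, hz⟩ := isCompact_univ.exists_isMinOn univ_nonempty hφ.continuousOn
    have hle (y : Circle) : φ z ≤ φ y := hz (mem_univ y)
    obtain ⟨ζ, hre, hζ⟩ := exists_re_lt_one_of_eventually h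
    refine ⟨z, (hnonneg z).antisymm' ?_⟩
    nlinarith [hζ z, hle (z * ζ⁻¹), hle (z * ζ)]
  exact eq_univ_iff_forall.1 (hzero.eq_univ hmin) z

end Circle

/-! ### Signatures -/

section Signature

variable {𝕜 : Type*} [Field 𝕜] [LinearOrder 𝕜]
  {M N : Type*} [AddCommGroup M] [Module 𝕜 M] [FiniteDimensional 𝕜 M]
  [AddCommGroup N] [Module 𝕜 N] {q : QuadraticForm 𝕜 M}

theorem finrank_le_sigPos (T : N →ₗ[𝕜] M) (hT : ∀ x, x ≠ 0 → 0 < q (T x)) :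
    Module.finrank 𝕜 N ≤ sigPos q := by
  have hinj : Function.Injective T := by
    rw [injective_iff_map_eq_zero]
    intro x hx
    by_contra hne
    exact (hT x hne).ne' (by rw [hx, QuadraticMap.map_zero])
  have hpos : (q.restrict (LinearMap.range T)).PosDef := by
    rintro ⟨_, x, rfl⟩ hx
    refine hT x ?_
    rintro rfl
    exact hx (Subtype.ext (map_zero T))
  rw [← LinearMap.finrank_range_of_inj hinj]
  exact le_sigPos_of_posDef q hpos

variable [IsStrictOrderedRing 𝕜]

theorem finrank_le_sigNeg (T : N →ₗ[𝕜] M) (hT : ∀ x, x ≠ 0 → q (T x) < 0) :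
    Module.finrank 𝕜 N ≤ sigNeg q := by
  rw [← sigPos_neg]
  exact finrank_le_sigPos T fun x hx => neg_pos.2 (hT x hx)

theorem finrank_add_sigNeg_le_of_nonneg {V : Submodule 𝕜 M} (hV : ∀ x ∈ V, 0 ≤ q x) :
    Module.finrank 𝕜 V + sigNeg q ≤ Module.finrank 𝕜 M := by
  rw [← sigPos_neg, add_comm]
  exact QuadraticForm.sigPos_add_finrank_le_of_nonpos fun x hx => neg_nonpos.2 (hV x hx)

end Signature

theorem exists_linearEquiv_norm_sq_eq {M : Type*} [AddCommGroup M] [Module ℝ M]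
    [FiniteDimensional ℝ M] {q : QuadraticForm ℝ M} (hq : q.PosDef) {k : ℕ}
    (hk : Module.finrank ℝ M = k) :
    ∃ e : M ≃ₗ[ℝ] EuclideanSpace ℝ (Fin k), ∀ x, q x = ‖e x‖ ^ 2 := by
  let c : InnerProductSpace.Core ℝ M :=
    { inner := fun x y => QuadraticMap.associated (R := ℝ) q x y
      conj_inner_symm := fun x y => by
        simpa using QuadraticMap.associated_isSymm ℝ q y x
      re_inner_nonneg := fun x => by
        simpa [QuadraticMap.associated_eq_self_apply] using hq.nonneg x
      add_left := fun x y z => by simp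
      smul_left := fun x y r => by simp
      definite := fun x hx => hq.anisotropic x <| by
        rwa [QuadraticMap.associated_eq_self_apply] at hx }
  let : NormedAddCommGroup M := c.toNormedAddCommGroup
  let : InnerProductSpace ℝ M := InnerProductSpace.ofCore c.toCore
  let e := ((stdOrthonormalBasis ℝ M).reindex (finCongr hk)).repr
  refine ⟨e.toLinearEquiv, fun x => ?_⟩
  calc q x = inner ℝ x x := (QuadraticMap.associated_eq_self_apply ℝ q x).symm
    _ = ‖x‖ ^ 2 := real_inner_self_eq_norm_sq x
    _ = ‖e x‖ ^ 2 := by rw [e.norm_map]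

variable {E : Type*} [NormedAddCommGroup E] [NormedSpace ℝ E]

section HasSignature

variable [FiniteDimensional ℝ E] {Q : QuadraticForm ℝ E} {F : Submodule ℝ E} {p q : ℕ}

theorem hasSignature_of_forall_pos_of_forall_neg
    {N N' : Type*} [AddCommGroup N] [Module ℝ N] [AddCommGroup N'] [Module ℝ N']
    (hF : Module.finrank ℝ F ≤ p + q)
    (T : N →ₗ[ℝ] E) (hTF : ∀ x, T x ∈ F) (hN : Module.finrank ℝ N = p)
    (hpos : ∀ x, x ≠ 0 → 0 < Q (T x))
    (T' : N' →ₗ[ℝ] E) (hTF' : ∀ x, T' x ∈ F) (hN' : Module.finrank ℝ N' = q)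
    (hneg : ∀ x, x ≠ 0 → Q (T' x) < 0) :
    HasSignature Q F p q := by
  have hp : p ≤ sigPos (Q.restrict F) :=
    hN ▸ finrank_le_sigPos (q := Q.restrict F) (T.codRestrict F hTF) hpos
  have hq : q ≤ sigNeg (Q.restrict F) :=
    hN' ▸ finrank_le_sigNeg (q := Q.restrict F) (T'.codRestrict F hTF') hneg
  have := QuadraticForm.sigPos_add_sigNeg_add_radical (Q := Q.restrict F)
  refine ⟨?_, ?_, ?_⟩ <;> omega

theorem HasSignature.finrank_le_of_nonneg {V : Submodule ℝ E} (h : HasSignature Q F p q)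
    (hVF : V ≤ F) (hV : ∀ x ∈ V, 0 ≤ Q x) : Module.finrank ℝ V ≤ p := by
  have hle := finrank_add_sigNeg_le_of_nonneg (q := Q.restrict F) (V := V.submoduleOf F)
    fun x hx => hV x hx
  rw [h.1, h.2.2, (Submodule.submoduleOfEquivOfLe hVF).finrank_eq] at hle
  omega

end HasSignature

/-! ### The scalar product -/

section Scal

variable (Q : QuadraticForm ℝ E)

theorem scal_self (x : E) : scal Q x x = Q x := QuadraticMap.associated_eq_self_apply ℝ Q x

theorem scal_comm (x y : E) : scal Q x y = scal Q y x := QuadraticMap.associated_isSymm ℝ Q x y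

theorem form_smul (c : ℝ) (x : E) : Q (c • x) = c ^ 2 * Q x := by
  rw [QuadraticMap.map_smul, smul_eq_mul, sq]

theorem form_add (x y : E) : Q (x + y) = Q x + 2 * scal Q x y + Q y := by
  simp only [← scal_self, map_add, LinearMap.add_apply, scal_comm Q y x]
  ring

theorem form_sub (x y : E) : Q (x - y) = Q x - 2 * scal Q x y + Q y := by
  rw [sub_eq_add_neg, form_add, map_neg, QuadraticMap.map_neg]
  ring

theorem form_smul_add_smul (a b : ℝ) (x y : E) :
    Q (a • x + b • y) = a ^ 2 * Q x + 2 * (a * b) * scal Q x y + b ^ 2 * Q y := by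
  rw [form_add, form_smul, form_smul, map_smul, LinearMap.map_smul₂, smul_eq_mul, smul_eq_mul]
  ring

variable [FiniteDimensional ℝ E]

/-- The scalar product as a continuous bilinear map, for use in differentiation. -/
def scalL : E →L[ℝ] E →L[ℝ] ℝ := LinearMap.toContinuousBilinearMap (scal Q)

theorem scalL_apply (x y : E) : scalL Q x y = scal Q x y := rfl

theorem contDiff_form {k : ℕ∞ω} : ContDiff ℝ k fun x => Q x := by
  simp only [← scal_self, ← scalL_apply]
  exact (scalL Q).contDiff.clm_apply contDiff_id

theorem continuous_form : Continuous fun x => Q x := (contDiff_form Q (k := 0)).continuous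

variable {Q} in
theorem continuous_scal {X : Type*} [TopologicalSpace X] {g h : X → E} (hg : Continuous g)
    (hh : Continuous h) : Continuous fun x => scal Q (g x) (h x) :=
  ((scalL Q).continuous.comp hg).clm_apply hh

end Scal

/-! ### Splittings adapted to a pointed hyperbolic plane -/

section Splitting

variable {F G : Type*} [NormedAddCommGroup F] [NormedSpace ℝ F] [NormedAddCommGroup G]
  [NormedSpace ℝ G] {Q : QuadraticForm ℝ E} {L : E ≃L[ℝ] F × G}

/-- `L` identifies `E` with a product of normed spaces so that `Q` becomes the difference of the
squared norms of the two components. -/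
def IsSplitting (Q : QuadraticForm ℝ E) (L : E ≃L[ℝ] F × G) : Prop :=
  ∀ x, Q x = ‖(L x).1‖ ^ 2 - ‖(L x).2‖ ^ 2

theorem IsSplitting.form_le_norm_fst_sq (hL : IsSplitting Q L) (x : E) :
    Q x ≤ ‖(L x).1‖ ^ 2 := by
  rw [hL x]
  exact sub_le_self _ (sq_nonneg _)

theorem IsSplitting.eq_zero_of_fst_eq_zero (hL : IsSplitting Q L) {x : E} (hfst : (L x).1 = 0)
    (hx : 0 ≤ Q x) : x = 0 := by
  rw [hL x, hfst, norm_zero] at hx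
  have hsnd : ‖(L x).2‖ = 0 := by nlinarith [norm_nonneg (L x).2]
  exact L.map_eq_zero_iff.1 (Prod.ext hfst (norm_eq_zero.1 hsnd))

end Splitting

namespace PointedPlane

variable {Q : QuadraticForm ℝ E} (P : PointedPlane Q)

theorem form_q : Q P.q = -1 := P.q_mem

theorem q_mem_W : P.q ∈ P.W := fun u hu => (scal_comm Q u P.q).trans (P.ortho u hu)

theorem scal_eq_zero {u w : E} (hu : u ∈ P.U) (hw : w ∈ P.W) : scal Q u w = 0 := hw u hu

theorem form_add_smul_q {u : E} (hu : u ∈ P.U) (c : ℝ) : Q (u + c • P.q) = Q u - c ^ 2 := by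
  rw [form_add, form_smul, map_smul, P.scal_eq_zero hu P.q_mem_W, P.form_q, smul_zero]
  ring

theorem scal_add_smul_q {u : E} (hu : u ∈ P.U) (c : ℝ) : scal Q (u + c • P.q) P.q = -c := by
  rw [LinearMap.map_add₂, LinearMap.map_smul₂, P.scal_eq_zero hu P.q_mem_W, scal_self, P.form_q]
  simp

theorem mem_plane_iff {x : E} : x ∈ P.plane ↔ ∃ u ∈ P.U, x = u + √(1 + Q u) • P.q := by
  constructor
  · rintro ⟨hx, hspan, hneg⟩
    obtain ⟨_, hy, u, hu, rfl⟩ := Submodule.mem_sup.1 hspan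
    obtain ⟨c, rfl⟩ := Submodule.mem_span_singleton.1 hy
    rw [add_comm] at hx hneg ⊢
    have hc : Q u - c ^ 2 = -1 := (P.form_add_smul_q hu c).symm.trans hx
    rw [P.scal_add_smul_q hu, neg_lt_zero] at hneg
    refine ⟨u, hu, ?_⟩
    rw [show 1 + Q u = c ^ 2 by linarith, Real.sqrt_sq hneg.le]
  · rintro ⟨u, hu, rfl⟩
    have hpos : 0 < 1 + Q u := by linarith [P.nonneg_of_mem_U hu]
    refine ⟨?_, ?_, ?_⟩
    · change Q _ = -1
      rw [P.form_add_smul_q hu, Real.sq_sqrt hpos.le]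
      ring
    · rw [add_comm]
      exact Submodule.add_mem_sup (Submodule.smul_mem _ _ (Submodule.mem_span_singleton_self _)) hu
    · rw [P.scal_add_smul_q hu]
      exact neg_lt_zero.2 (Real.sqrt_pos.2 hpos)

theorem q_mem_plane : P.q ∈ P.plane :=
  P.mem_plane_iff.2 ⟨0, P.U.zero_mem, by simp⟩

variable [FiniteDimensional ℝ E]

theorem projU_of_mem_U {u : E} (hu : u ∈ P.U) : P.projU u = u :=
  (Submodule.projection_eq_self_iff P.isCompl u).2 hu

theorem projU_eq_zero_iff {w : E} : P.projU w = 0 ↔ w ∈ P.W :=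
  Submodule.projection_apply_eq_zero_iff P.isCompl

theorem projU_q : P.projU P.q = 0 := P.projU_eq_zero_iff.2 P.q_mem_W

theorem sub_projU_mem (x : E) : x - P.projU x ∈ P.W := by
  rw [← P.projU_eq_zero_iff, map_sub, P.projU_of_mem_U (P.projU_mem x), sub_self]

theorem form_eq_projU_add (x : E) : Q x = Q (P.projU x) + Q (x - P.projU x) := by
  have h := form_add Q (P.projU x) (x - P.projU x)
  rwa [P.scal_eq_zero (P.projU_mem x) (P.sub_projU_mem x), mul_zero, add_zero,
    add_sub_cancel] at h

theorem warpedProj_eq (x : E) :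
    P.warpedProj x = P.projU x + √(1 + Q (P.projU x)) • P.q := by
  have h0 := P.nonneg_of_mem_U (P.projU_mem x)
  set s := √(1 + Q (P.projU x)) with hs
  have hs0 : 0 < s := Real.sqrt_pos.2 (by positivity)
  have hform : Q (P.projU x) = s ^ 2 - 1 := by
    rw [hs, Real.sq_sqrt (by positivity)]
    ring
  have hdisk : Q (P.diskCoord x) = (s - 1) / (1 + s) := by
    rw [diskCoord, ← hs, form_smul, hform]
    field_simp
    ring
  have hden : 1 - (s - 1) / (1 + s) = 2 / (1 + s) := by field_simp; ring
  have hnum : 1 + (s - 1) / (1 + s) = 2 * s / (1 + s) := by field_simp; ring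
  rw [warpedProj, warp, hdisk, hden, hnum, diskCoord, ← hs, smul_smul]
  congr 2
  · rw [show 2 / (2 / (1 + s)) * (1 + s)⁻¹ = 1 by field_simp, one_smul]
  · field_simp

theorem projU_warpedProj (x : E) : P.projU (P.warpedProj x) = P.projU x := by
  rw [warpedProj_eq, map_add, map_smul, projU_q, P.projU_of_mem_U (P.projU_mem x), smul_zero,
    add_zero]

theorem warpedProj_eq_iff {x y : E} : P.warpedProj x = P.warpedProj y ↔ P.projU x = P.projU y := by
  refine ⟨fun h => ?_, fun h => by rw [warpedProj_eq, warpedProj_eq, h]⟩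
  rw [← projU_warpedProj, h, projU_warpedProj]

variable {m : ℕ}

theorem neg_of_mem_W (hQ : HasSignature Q ⊤ 2 m) {w : E} (hw : w ∈ P.W) (hne : w ≠ 0) :
    Q w < 0 := by
  by_contra! hpos
  have hnonneg : ∀ x ∈ P.U ⊔ (ℝ ∙ w), 0 ≤ Q x := by
    intro x hx
    obtain ⟨u, hu, _, hy, rfl⟩ := Submodule.mem_sup.1 hx
    obtain ⟨c, rfl⟩ := Submodule.mem_span_singleton.1 hy
    rw [form_add, P.scal_eq_zero hu (P.W.smul_mem c hw), form_smul]
    have := P.nonneg_of_mem_U hu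
    positivity
  have hdisj : Disjoint P.U (ℝ ∙ w) :=
    P.isCompl.disjoint.mono_right ((Submodule.span_singleton_le_iff_mem w P.W).2 hw)
  have hrank := Submodule.finrank_sup_add_finrank_inf_eq P.U (ℝ ∙ w)
  rw [hdisj.eq_bot, finrank_bot, P.finrank_U, finrank_span_singleton hne] at hrank
  have := hQ.finrank_le_of_nonneg le_top hnonneg
  omega

theorem finrank_W (hQ : HasSignature Q ⊤ 2 m) : Module.finrank ℝ P.W = m := by
  have hsum := Submodule.finrank_add_eq_of_isCompl P.isCompl
  have htop := hQ.1
  rw [finrank_top] at htop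
  rw [P.finrank_U] at hsum
  omega

theorem exists_isSplitting (hQ : HasSignature Q ⊤ 2 m) :
    ∃ L : E ≃L[ℝ] EuclideanSpace ℝ (Fin 2) × EuclideanSpace ℝ (Fin m),
      IsSplitting Q L ∧ ∀ x, P.projU x = L.symm ((L x).1, 0) := by
  obtain ⟨e, he⟩ := exists_linearEquiv_norm_sq_eq P.posDef_U P.finrank_U
  have hneg : ((-Q).restrict P.W).PosDef := fun w hne =>
    neg_pos.2 (P.neg_of_mem_W hQ w.2 fun h => hne (Subtype.ext h))
  obtain ⟨e', he'⟩ := exists_linearEquiv_norm_sq_eq hneg (P.finrank_W hQ)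
  let L := (Submodule.prodEquivOfIsCompl _ _ P.isCompl).symm ≪≫ₗ e.prodCongr e'
  have hadd (u : P.U) (w : P.W) : L (u + w : E) = (e u, e' w) := by
    have huw : (u + w : E) = Submodule.prodEquivOfIsCompl _ _ P.isCompl (u, w) := rfl
    rw [huw, LinearEquiv.trans_apply, LinearEquiv.symm_apply_apply]
    rfl
  have hL (x : E) : L x = (e ⟨_, P.projU_mem x⟩, e' ⟨_, P.sub_projU_mem x⟩) := by
    rw [← hadd, add_sub_cancel]
  refine ⟨L.toContinuousLinearEquiv, fun x => ?_, fun x => ?_⟩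
  · change Q x = ‖(L x).1‖ ^ 2 - ‖(L x).2‖ ^ 2
    rw [hL, ← he, ← he', P.form_eq_projU_add]
    simp
  · change P.projU x = L.symm ((L x).1, 0)
    rw [LinearEquiv.eq_symm_apply, hL x]
    simpa using hadd ⟨_, P.projU_mem x⟩ 0

end PointedPlane

variable {Q : QuadraticForm ℝ E}

/-! ### Negative definite subspaces and pointed hyperbolic planes -/

section NegativeDefinite

variable [FiniteDimensional ℝ E] {N : Submodule ℝ E}

theorem isCompl_orthogonal_of_neg (hN : ∀ v ∈ N, v ≠ 0 → Q v < 0) :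
    IsCompl N ((scal Q).orthogonal N) := by
  have hs : (scal Q).IsSymm := ⟨scal_comm Q⟩
  have hzero (v : N) (hv : scal Q v v = 0) : v = 0 := by
    by_contra hne
    have := hN v v.2 fun h => hne (Subtype.ext h)
    rw [← scal_self, hv] at this
    exact lt_irrefl _ this
  exact LinearMap.BilinForm.isCompl_orthogonal_of_restrict_nondegenerate hs.isRefl
    ⟨fun v hv => hzero v (hv v), fun v hv => hzero v (hv v)⟩

/-- Projecting a pointed hyperbolic plane along `N` onto the orthogonal of `N` does not decrease
the form, hence preserves positive definiteness. -/
theorem PointedPlane.exists_le_W (P : PointedPlane Q) (hN : ∀ v ∈ N, v ≠ 0 → Q v < 0) {x : E}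
    (hx : x ∈ N) (hQx : Q x = -1) : ∃ P' : PointedPlane Q, N ≤ P'.W := by
  have hc := (isCompl_orthogonal_of_neg hN).symm
  let T : E →ₗ[ℝ] E := ((scal Q).orthogonal N).projection N hc
  have hT (v : E) (hv : v ∈ N) (u : E) : scal Q v (T u) = 0 :=
    Submodule.projection_apply_mem hc u v hv
  have hle (u : E) : Q u ≤ Q (T u) := by
    have hmem : u - T u ∈ N := by
      rw [← Submodule.projection_apply_eq_zero_iff hc, map_sub, sub_eq_zero]
      exact ((Submodule.projection_eq_self_iff hc _).2 (Submodule.projection_apply_mem hc u)).symm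
    have hneg : Q (u - T u) ≤ 0 := by
      rcases eq_or_ne (u - T u) 0 with h | h
      · rw [h, QuadraticMap.map_zero]
      · exact (hN _ hmem h).le
    have := form_add Q (u - T u) (T u)
    rw [sub_add_cancel, hT _ hmem] at this
    linarith
  have hpos (u : P.U) (hu : u ≠ 0) : 0 < Q (T u) := (P.posDef_U u hu).trans_le (hle u)
  have hinj : Function.Injective (T.domRestrict P.U) := by
    rw [injective_iff_map_eq_zero]
    intro u h0
    by_contra hne
    exact (hpos u hne).ne' ((congrArg Q h0).trans (QuadraticMap.map_zero Q))
  refine ⟨⟨x, LinearMap.range (T.domRestrict P.U), hQx, ?_, ?_, ?_⟩, ?_⟩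
  · rw [LinearMap.finrank_range_of_inj hinj, P.finrank_U]
  · rintro ⟨_, u, rfl⟩ hne
    refine hpos u ?_
    rintro rfl
    exact hne (Subtype.ext (map_zero T))
  · rintro _ ⟨u, rfl⟩
    exact hT x hx u
  · rintro v hv _ ⟨u, rfl⟩
    exact (scal_comm Q _ v).trans (hT v hv u)

end NegativeDefinite

theorem form_smul_add_smul_neg {x y : E} (hx : Q x = -1) (hy : Q y = -1)
    (hxy : scal Q x y ^ 2 < 1) {a b : ℝ} (hab : a ≠ 0 ∨ b ≠ 0) : Q (a • x + b • y) < 0 := by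
  rw [form_smul_add_smul, hx, hy]
  set c := scal Q x y
  obtain ⟨hc, hc'⟩ := abs_lt.1 ((sq_lt_one_iff_abs_lt_one c).1 hxy)
  have hsq : 0 < a ^ 2 + b ^ 2 := by rcases hab with h | h <;> positivity
  nlinarith [mul_nonneg (by linarith : 0 ≤ 1 + c) (sq_nonneg (a - b)),
    mul_nonneg (by linarith : 0 ≤ 1 - c) (sq_nonneg (a + b))]

theorem isAcausalPair_of_one_lt_sq [FiniteDimensional ℝ E] {x y : PseudoHyp Q}
    (h : 1 < scal Q (x : E) y ^ 2) : IsAcausalPair Q x y := by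
  have hx : Q (x : E) = -1 := x.2
  have hy : Q (y : E) = -1 := y.2
  have hxs : (x : E) ∈ Submodule.span ℝ {(x : E), (y : E)} := Submodule.subset_span (by simp)
  have hys : (y : E) ∈ Submodule.span ℝ {(x : E), (y : E)} := Submodule.subset_span (by simp)
  have hsmul {v : E} (hv : v ∈ Submodule.span ℝ {(x : E), (y : E)}) (r : ℝ) :
      LinearMap.toSpanSingleton ℝ E v r ∈ Submodule.span ℝ {(x : E), (y : E)} :=
    Submodule.smul_mem _ r hv
  refine hasSignature_of_forall_pos_of_forall_neg (N := ℝ) (N' := ℝ) ?_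
    (LinearMap.toSpanSingleton ℝ E (scal Q (x : E) y • x + (1 : ℝ) • y))
    (hsmul (add_mem (Submodule.smul_mem _ _ hxs) (Submodule.smul_mem _ _ hys))) (by simp)
    (fun r hr => ?_) (LinearMap.toSpanSingleton ℝ E x) (hsmul hxs) (by simp) (fun r hr => ?_)
  · classical
    have := finrank_span_finset_le_card (R := ℝ) (M := E) {(x : E), (y : E)}
    simp only [Finset.coe_insert, Finset.coe_singleton] at this
    exact this.trans Finset.card_le_two
  · rw [LinearMap.toSpanSingleton_apply, form_smul, form_smul_add_smul, hx, hy]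
    exact mul_pos (by positivity) (by nlinarith)
  · rw [LinearMap.toSpanSingleton_apply, form_smul, hx]
    have : 0 < r ^ 2 := by positivity
    linarith

section ProjInjective

variable [FiniteDimensional ℝ E] {S : Type*} {f : S → PseudoHyp Q}

/-- All the orthogonal projections of the surface onto positive definite planes are injective.
This is the part of being an entire graph which forces acausality. -/
def ProjInjective (Q : QuadraticForm ℝ E) (f : S → PseudoHyp Q) : Prop :=
  ∀ P : PointedPlane Q, Function.Injective fun s => P.projU (f s : E)

theorem ProjInjective.eq_of_mem_W (hi : ProjInjective Q f) {P : PointedPlane Q} {s t : S}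
    (hs : (f s : E) ∈ P.W) (ht : (f t : E) ∈ P.W) : s = t :=
  hi P ((P.projU_eq_zero_iff.2 hs).trans (P.projU_eq_zero_iff.2 ht).symm)

end ProjInjective

/-! ### Local structure of spacelike surfaces -/

theorem hasFDerivAt_form [FiniteDimensional ℝ E] (x : E) :
    HasFDerivAt (fun y => Q y) ((2 : ℝ) • scalL Q x) x := by
  have h : HasFDerivAt (fun y => scalL Q y y) _ x :=
    (scalL Q).hasFDerivAt.clm_apply (hasFDerivAt_id x)
  simp only [scalL_apply, scal_self] at h
  refine h.congr_fderiv (ContinuousLinearMap.ext fun v => ?_)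
  change scal Q x v + scal Q v x = 2 * scal Q x v
  rw [scal_comm Q v x, two_mul]

/-- The plane in which the charts of a surface take their values. -/
abbrev ModelPlane := EuclideanSpace ℝ (Fin 2)

section Surface

variable {S : Type*} [TopologicalSpace S] [ChartedSpace (EuclideanSpace ℝ (Fin 2)) S]
  {f : S → PseudoHyp Q}

/-- A chart of the surface around `s` in which `f` becomes a smooth spacelike parametrization. -/
structure LocalParam (Q : QuadraticForm ℝ E) (f : S → PseudoHyp Q) (s : S) where
  chart : OpenPartialHomeomorph S ModelPlane
  mem_source : s ∈ chart.source
  contMDiffOn_symm : ContMDiffOn 𝓘(ℝ, ModelPlane) (𝓡 2) ∞ chart.symm chart.target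
  contDiffAt : ∀ y ∈ chart.target, ContDiffAt ℝ ∞ (fun z => (f (chart.symm z) : E)) y
  pos : ∀ y ∈ chart.target, ∀ ξ : ModelPlane, ξ ≠ 0 →
    0 < Q (fderiv ℝ (fun z => (f (chart.symm z) : E)) y ξ)

theorem IsSpacelikeImmersion.exists_localParam [IsManifold (𝓡 2) ∞ S]
    (hf : IsSpacelikeImmersion Q f) (s : S) : Nonempty (LocalParam Q f s) := by
  let c := chartAt ModelPlane s
  have hsymm : ContMDiffOn 𝓘(ℝ, ModelPlane) (𝓡 2) ∞ c.symm c.target := contMDiffOn_chart_symm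
  have hc := mdifferentiable_chart (I := 𝓡 2) s
  refine ⟨⟨c, mem_chart_source _ s, hsymm, fun y hy => ?_, fun y hy ξ hξ => ?_⟩⟩
  · exact ((hf.1.contMDiffAt (x := c.symm y)).comp y
      ((hsymm y hy).contMDiffAt (c.open_target.mem_nhds hy))).contDiffAt
  · have hfc : MDifferentiableAt (𝓡 2) 𝓘(ℝ, E) (fun t => (f t : E)) (c.symm y) :=
      (hf.1.contMDiffAt (x := c.symm y)).mdifferentiableAt (by simp)
    have hcomp := mfderiv_comp y hfc (hc.mdifferentiableAt_symm hy)
    rw [mfderiv_eq_fderiv] at hcomp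
    have hne : mfderiv 𝓘(ℝ, ModelPlane) (𝓡 2) c.symm y ξ ≠ 0 := fun h0 =>
      hξ (hc.symm.mfderiv_injective (x := y) hy (h0.trans (map_zero _).symm))
    exact (hf.2 _ _ hne).trans_eq (congrArg (fun T => Q (T ξ)) hcomp).symm

namespace LocalParam

variable {s : S} (p : LocalParam Q f s)

/-- The parametrization of the surface by the plane, with values in the vector space. -/
def map (z : ModelPlane) : E := f (p.chart.symm z)

/-- The derivative of the parametrization at the base point. -/
protected def deriv : ModelPlane →L[ℝ] E := fderiv ℝ p.map (p.chart s)

theorem mem_target : p.chart s ∈ p.chart.target := p.chart.map_source p.mem_source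

theorem map_base : p.map (p.chart s) = f s := by
  rw [map, p.chart.left_inv p.mem_source]

theorem hasFDerivAt : HasFDerivAt p.map p.deriv (p.chart s) :=
  ((p.contDiffAt _ p.mem_target).differentiableAt (by simp)).hasFDerivAt

theorem deriv_pos {ξ : ModelPlane} (hξ : ξ ≠ 0) : 0 < Q (p.deriv ξ) := p.pos _ p.mem_target ξ hξ

theorem deriv_injective : Function.Injective p.deriv := by
  rw [injective_iff_map_eq_zero]
  intro ξ h
  by_contra hne
  exact (p.deriv_pos hne).ne' ((congrArg Q h).trans (QuadraticMap.map_zero Q))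

theorem apply_deriv_eq_zero_of_isLocalExtr {g : E → ℝ} {g' : E →L[ℝ] ℝ}
    (hg : HasFDerivAt g g' (f s)) (h : IsLocalExtr (fun t => g (f t)) s) (ξ : ModelPlane) :
    g' (p.deriv ξ) = 0 := by
  have hbase : p.chart.symm (p.chart s) = s := p.chart.left_inv p.mem_source
  have hext : IsLocalExtr (g ∘ p.map) (p.chart s) :=
    (hbase.symm ▸ h : IsLocalExtr (fun t => g (f t)) (p.chart.symm (p.chart s))).comp_continuous
      (p.chart.continuousAt_symm p.mem_target)
  exact congrArg (fun T => T ξ)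
    (hext.hasFDerivAt_eq_zero ((p.map_base.symm ▸ hg).comp _ p.hasFDerivAt))

variable [FiniteDimensional ℝ E]

theorem scal_deriv_base (ξ : ModelPlane) : scal Q (f s) (p.deriv ξ) = 0 := by
  have hconst (t : S) : Q (f t : E) = -1 := (f t).2
  have hext : IsLocalExtr (fun t => Q (f t : E)) s := by
    simp only [hconst]
    exact isLocalExtr_const
  have h := p.apply_deriv_eq_zero_of_isLocalExtr (hasFDerivAt_form _) hext ξ
  exact (mul_eq_zero_iff_left two_ne_zero).1 h

/-- The pointed hyperbolic plane tangent to the surface. -/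
def tangentPlane : PointedPlane Q where
  q := f s
  U := LinearMap.range (p.deriv : ModelPlane →ₗ[ℝ] E)
  q_mem := (f s).2
  finrank_U := by
    rw [LinearMap.finrank_range_of_inj p.deriv_injective, finrank_euclideanSpace_fin]
  posDef_U := by
    rintro ⟨_, ξ, rfl⟩ hne
    refine p.deriv_pos ?_
    rintro rfl
    exact hne (Subtype.ext (map_zero p.deriv))
  ortho := by
    rintro _ ⟨ξ, rfl⟩
    exact p.scal_deriv_base ξ

theorem mem_tangentPlane_W {y : E} (h : ∀ ξ, scal Q y (p.deriv ξ) = 0) :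
    y ∈ p.tangentPlane.W := by
  rintro _ ⟨ξ, rfl⟩
  exact (scal_comm Q _ y).trans (h ξ)

end LocalParam

/-! ### Acausality -/

section Acausal

variable [FiniteDimensional ℝ E]

theorem IsEntireGraph.projInjective (h : IsEntireGraph Q f) : ProjInjective Q f := by
  intro P s t hst
  obtain ⟨-, -, ψ, -, hψ, -⟩ := h P
  rw [← hψ s, ← hψ t]
  exact congrArg ψ (P.warpedProj_eq_iff.2 hst)

theorem IsEntireGraph.existsUnique_mem (h : IsEntireGraph Q f) {A : Set (PseudoHyp Q)}
    (hA : IsTimelikeSphere Q A) : ∃! s : S, f s ∈ A := by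
  obtain ⟨P, rfl⟩ := hA
  obtain ⟨-, -, ψ, -, hψ, hφ⟩ := h P
  refine ⟨ψ P.q, hφ P.q P.q_mem_plane, fun s hs => ?_⟩
  rw [← hψ s]
  exact congrArg ψ hs

namespace ProjInjective

variable {s t : S} [IsManifold (𝓡 2) ∞ S]

theorem one_le_scal_sq (hi : ProjInjective Q f) (hf : IsSpacelikeImmersion Q f) (s t : S) :
    1 ≤ scal Q (f s : E) (f t) ^ 2 := by
  by_contra! hlt
  have hN : ∀ v ∈ Submodule.span ℝ {(f s : E), (f t : E)}, v ≠ 0 → Q v < 0 := by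
    intro v hv hne
    obtain ⟨a, b, rfl⟩ := Submodule.mem_span_pair.1 hv
    refine form_smul_add_smul_neg (f s).2 (f t).2 hlt ?_
    contrapose! hne
    rw [hne.1, hne.2, zero_smul, zero_smul, add_zero]
  obtain ⟨p⟩ := hf.exists_localParam s
  have hs := Submodule.mem_span_of_mem (R := ℝ) (Set.mem_insert (f s : E) {(f t : E)})
  have ht := Submodule.mem_span_of_mem (R := ℝ)
    (Set.mem_insert_of_mem (f s : E) (Set.mem_singleton (f t : E)))
  obtain ⟨P, hP⟩ := p.tangentPlane.exists_le_W hN hs (f s).2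
  obtain rfl : s = t := hi.eq_of_mem_W (hP hs) (hP ht)
  rw [scal_self, show Q (f s : E) = -1 from (f s).2] at hlt
  norm_num at hlt

theorem one_lt_scal_sq (hi : ProjInjective Q f) (hf : IsSpacelikeImmersion Q f) (hst : s ≠ t) :
    1 < scal Q (f s : E) (f t) ^ 2 := by
  refine (hi.one_le_scal_sq hf s t).lt_of_ne fun hone => hst ?_
  obtain ⟨p⟩ := hf.exists_localParam s
  have hmin : IsLocalMin (fun s' => scalL Q (f t : E) (f s') ^ 2) s :=
    Filter.Eventually.of_forall fun s' => by
      simp only [scalL_apply, scal_comm Q (f t : E)]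
      exact hone.symm.trans_le (hi.one_le_scal_sq hf s' t)
  have hne : scal Q (f t : E) (f s) ≠ 0 := by
    intro h0
    rw [scal_comm, h0] at hone
    norm_num at hone
  refine hi.eq_of_mem_W (p.mem_tangentPlane_W p.scal_deriv_base)
    (p.mem_tangentPlane_W fun ξ => ?_)
  have hder := p.apply_deriv_eq_zero_of_isLocalExtr
    ((scalL Q (f t : E)).hasFDerivAt.pow 2) (Or.inl hmin) ξ
  simpa [hne, scalL_apply] using hder

theorem isAcausalSet (hi : ProjInjective Q f) (hf : IsSpacelikeImmersion Q f) :
    IsAcausalSet Q (Set.range f) := by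
  rintro _ ⟨s, rfl⟩ _ ⟨t, rfl⟩ hst
  exact isAcausalPair_of_one_lt_sq (hi.one_lt_scal_sq hf (ne_of_apply_ne f hst))

theorem scal_le [PreconnectedSpace S] (hi : ProjInjective Q f) (hf : IsSpacelikeImmersion Q f)
    (s t : S) : scal Q (f s : E) (f t) ≤ -1 := by
  by_contra! hlt
  have hcont : Continuous fun s' => scal Q (f s' : E) (f t) :=
    continuous_scal hf.1.continuous continuous_const
  have hbase : scal Q (f t : E) (f t) ≤ 0 := by
    rw [scal_self, show Q (f t : E) = -1 from (f t).2]
    norm_num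
  have hnonneg : 0 ≤ scal Q (f s : E) (f t) := by nlinarith [hi.one_le_scal_sq hf s t]
  obtain ⟨s', hs' : scal Q (f s' : E) (f t) = 0⟩ :=
    mem_range_of_exists_le_of_exists_ge hcont ⟨t, hbase⟩ ⟨s, hnonneg⟩
  have := hi.one_le_scal_sq hf s' t
  rw [hs'] at this
  norm_num at this

end ProjInjective

end Acausal

/-! ### Charts given by a projection -/

variable {A : E →L[ℝ] ModelPlane}

namespace LocalParam

variable {s : S} (p : LocalParam Q f s)

theorem exists_equiv_hasFDerivAt (hA : ∀ x, Q x ≤ ‖A x‖ ^ 2) {y : ModelPlane}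
    (hy : y ∈ p.chart.target) : ∃ T : ModelPlane ≃L[ℝ] ModelPlane,
      HasFDerivAt (fun z => A (p.map z)) (T : ModelPlane →L[ℝ] ModelPlane) y := by
  have hder : HasFDerivAt (fun z => A (p.map z)) (A.comp (fderiv ℝ p.map y)) y :=
    A.hasFDerivAt.comp y ((p.contDiffAt y hy).differentiableAt (by simp)).hasFDerivAt
  have hinj : Function.Injective
      (A.comp (fderiv ℝ p.map y) : ModelPlane →ₗ[ℝ] ModelPlane) := by
    rw [injective_iff_map_eq_zero]
    intro ξ (hξ : A (fderiv ℝ (fun z => (f (p.chart.symm z) : E)) y ξ) = 0)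
    by_contra hne
    have hlt := (p.pos y hy ξ hne).trans_le (hA _)
    rw [hξ] at hlt
    simp at hlt
  exact ⟨(LinearEquiv.ofInjectiveEndo _ hinj).toContinuousLinearEquiv,
    hder.congr_fderiv (ContinuousLinearMap.ext fun ξ => rfl)⟩

/-- Change of coordinates by a local diffeomorphism `h` of the plane. -/
def trans (h : OpenPartialHomeomorph ModelPlane ModelPlane) (hs : p.chart s ∈ h.source)
    (hsymm : ∀ y ∈ h.target, h.symm y ∈ p.chart.target → ContDiffAt ℝ ∞ h.symm y ∧
      ∃ T : ModelPlane ≃L[ℝ] ModelPlane,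
        HasFDerivAt h.symm (T : ModelPlane →L[ℝ] ModelPlane) y) :
    LocalParam Q f s where
  chart := p.chart.trans h
  mem_source := by
    rw [OpenPartialHomeomorph.trans_source]
    exact ⟨p.mem_source, hs⟩
  contMDiffOn_symm y hy := by
    rw [OpenPartialHomeomorph.trans_target] at hy
    have hp := (p.contMDiffOn_symm _ hy.2).contMDiffAt (p.chart.open_target.mem_nhds hy.2)
    exact (hp.comp y (hsymm y hy.1 hy.2).1.contMDiffAt).contMDiffWithinAt
  contDiffAt y hy := by
    rw [OpenPartialHomeomorph.trans_target] at hy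
    exact (p.contDiffAt _ hy.2).comp y (hsymm y hy.1 hy.2).1
  pos y hy ξ hξ := by
    rw [OpenPartialHomeomorph.trans_target] at hy
    obtain ⟨T, hT⟩ := (hsymm y hy.1 hy.2).2
    have hder : HasFDerivAt (fun z => (f ((p.chart.trans h).symm z) : E))
        ((fderiv ℝ p.map (h.symm y)).comp (T : ModelPlane →L[ℝ] ModelPlane)) y :=
      ((p.contDiffAt _ hy.2).differentiableAt (by simp)).hasFDerivAt.comp y hT
    rw [hder.fderiv]
    exact p.pos _ hy.2 _ ((map_ne_zero_iff _ T.injective).2 hξ)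

end LocalParam

namespace IsSpacelikeImmersion

variable [IsManifold (𝓡 2) ∞ S]

theorem exists_graphParam (hf : IsSpacelikeImmersion Q f) (hA : ∀ x, Q x ≤ ‖A x‖ ^ 2) (s : S) :
    ∃ p : LocalParam Q f s, ∀ t ∈ p.chart.source, p.chart t = A (f t) := by
  obtain ⟨p⟩ := hf.exists_localParam s
  have hsmooth {y : ModelPlane} (hy : y ∈ p.chart.target) :
      ContDiffAt ℝ ∞ (fun z => A (p.map z)) y :=
    A.contDiff.contDiffAt.comp y (p.contDiffAt y hy)
  obtain ⟨T, hT⟩ := p.exists_equiv_hasFDerivAt hA p.mem_target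
  let h := (hsmooth p.mem_target).toOpenPartialHomeomorph _ hT (by simp)
  refine ⟨p.trans h ((hsmooth p.mem_target).mem_toOpenPartialHomeomorph_source hT (by simp))
    fun y hy hy' => ?_, fun t ht => ?_⟩
  · obtain ⟨T', hT'⟩ := p.exists_equiv_hasFDerivAt hA hy'
    exact ⟨h.contDiffAt_symm hy hT' (hsmooth hy'), T'.symm, h.hasFDerivAt_symm hy hT'⟩
  · change t ∈ (p.chart.trans h).source at ht
    rw [OpenPartialHomeomorph.trans_source] at ht
    change A (f (p.chart.symm (p.chart t))) = _
    rw [p.chart.left_inv ht.1]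

theorem isLocalHomeomorph (hf : IsSpacelikeImmersion Q f) (hA : ∀ x, Q x ≤ ‖A x‖ ^ 2) :
    IsLocalHomeomorph fun s => A (f s) := by
  refine IsLocalHomeomorph.mk _ fun s => ?_
  obtain ⟨p, hp⟩ := hf.exists_graphParam hA s
  exact ⟨p.chart, p.mem_source, fun t ht => (hp t ht).symm⟩

theorem contMDiffAt_lift (hf : IsSpacelikeImmersion Q f) (hA : ∀ x, Q x ≤ ‖A x‖ ^ 2)
    {V : Type*} [NormedAddCommGroup V] [NormedSpace ℝ V] {g : V → S} {γ : V → ModelPlane} {t : V}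
    (hg : ContinuousAt g t) (hlift : ∀ᶠ r in 𝓝 t, A (f (g r)) = γ r)
    (hγ : ContDiffAt ℝ ∞ γ t) : ContMDiffAt 𝓘(ℝ, V) (𝓡 2) ∞ g t := by
  obtain ⟨p, hp⟩ := hf.exists_graphParam hA (g t)
  have hev : g =ᶠ[𝓝 t] p.chart.symm ∘ γ := by
    filter_upwards [hlift, hg.preimage_mem_nhds (p.chart.open_source.mem_nhds p.mem_source)]
      with r hr hr'
    rw [Function.comp_apply, ← hr, ← hp _ hr', p.chart.left_inv hr']
  have ht : γ t ∈ p.chart.target := by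
    rw [← hlift.self_of_nhds, ← hp _ p.mem_source]
    exact p.mem_target
  exact (((p.contMDiffOn_symm _ ht).contMDiffAt (p.chart.open_target.mem_nhds ht)).comp t
    hγ.contMDiffAt).congr_of_eventuallyEq hev

end IsSpacelikeImmersion

/-! ### Lengths for the induced metric -/

section Length

open MeasureTheory Set

/-- The norm of the induced metric on the tangent plane at `s`, as in the definition of
`inducedEDist`. -/
abbrev formENorm (Q : QuadraticForm ℝ E) (f : S → PseudoHyp Q) (s : S) :
    ENorm (TangentSpace (𝓡 2) s) := ⟨fun v => ENNReal.ofReal √(firstForm Q f s v)⟩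

theorem firstForm_smul (s : S) (r : ℝ) (v : TangentSpace (𝓡 2) s) :
    firstForm Q f s (r • v) = r ^ 2 * firstForm Q f s v := by
  rw [firstForm, map_smul]
  exact form_smul Q r _

theorem formENorm_smulClass (s : S) :
    letI := formENorm Q f s
    ENormSMulClass ℝ (TangentSpace (𝓡 2) s) := by
  let := formENorm Q f s
  refine ⟨fun r v => ?_⟩
  change ENNReal.ofReal √(firstForm Q f s (r • v)) = ‖r‖ₑ * ENNReal.ofReal √(firstForm Q f s v)
  rw [firstForm_smul, Real.sqrt_mul (sq_nonneg r), Real.sqrt_sq_eq_abs,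
    ENNReal.ofReal_mul (abs_nonneg r), Real.enorm_eq_ofReal_abs]

theorem inducedEDist_comm (x y : S) : inducedEDist Q f x y = inducedEDist Q f y x := by
  let : ∀ s : S, ENorm (TangentSpace (𝓡 2) s) := formENorm Q f
  have : ∀ s : S, ENormSMulClass ℝ (TangentSpace (𝓡 2) s) := formENorm_smulClass
  exact Manifold.riemannianEDist_comm

namespace IsSpacelikeImmersion

variable {γ : ℝ → S}

theorem firstForm_mfderiv (hf : IsSpacelikeImmersion Q f) {t : ℝ}
    (hγ : MDifferentiableAt 𝓘(ℝ, ℝ) (𝓡 2) γ t) :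
    firstForm Q f (γ t) (mfderiv 𝓘(ℝ, ℝ) (𝓡 2) γ t (1 : ℝ)) =
      Q (deriv (fun r => (f (γ r) : E)) t) := by
  have hfγ : MDifferentiableAt (𝓡 2) 𝓘(ℝ, E) (fun t => (f t : E)) (γ t) :=
    (hf.1.contMDiffAt (x := γ t)).mdifferentiableAt (by simp)
  have hchain := mfderiv_comp t hfγ hγ
  rw [mfderiv_eq_fderiv] at hchain
  exact congrArg (fun T => Q (T (1 : ℝ))) hchain.symm

theorem pathELength_eq (hf : IsSpacelikeImmersion Q f) {a b : ℝ}
    (hγ : ContMDiffOn 𝓘(ℝ, ℝ) (𝓡 2) 1 γ (Icc a b)) :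
    letI := formENorm Q f
    Manifold.pathELength (𝓡 2) γ a b =
      ∫⁻ t in Ioo a b, ENNReal.ofReal √(Q (deriv (fun r => (f (γ r) : E)) t)) := by
  let : ∀ s : S, ENorm (TangentSpace (𝓡 2) s) := formENorm Q f
  rw [Manifold.pathELength_eq_lintegral_mfderiv_Ioo]
  refine setLIntegral_congr_fun measurableSet_Ioo fun t ht => ?_
  have hd : MDifferentiableAt 𝓘(ℝ, ℝ) (𝓡 2) γ t :=
    ((hγ t ⟨ht.1.le, ht.2.le⟩).contMDiffAt (Icc_mem_nhds ht.1 ht.2)).mdifferentiableAt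
      (by simp)
  exact congrArg (fun r => ENNReal.ofReal √r) (hf.firstForm_mfderiv hd)

theorem inducedEDist_le (hf : IsSpacelikeImmersion Q f) {a b C : ℝ} (hab : a ≤ b)
    (hγ : ContMDiffOn 𝓘(ℝ, ℝ) (𝓡 2) 1 γ (Icc a b)) (hC : 0 ≤ C)
    (h : ∀ t ∈ Ioo a b, Q (deriv (fun r => (f (γ r) : E)) t) ≤ C ^ 2) :
    inducedEDist Q f (γ a) (γ b) ≤ ENNReal.ofReal (C * (b - a)) := by
  let : ∀ s : S, ENorm (TangentSpace (𝓡 2) s) := formENorm Q f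
  have : ∀ s : S, ENormSMulClass ℝ (TangentSpace (𝓡 2) s) := formENorm_smulClass
  calc inducedEDist Q f (γ a) (γ b) ≤ Manifold.pathELength (𝓡 2) γ a b :=
        Manifold.riemannianEDist_le_pathELength hγ rfl rfl hab
    _ = ∫⁻ t in Ioo a b, ENNReal.ofReal √(Q (deriv (fun r => (f (γ r) : E)) t)) :=
        hf.pathELength_eq hγ
    _ ≤ ∫⁻ _ in Ioo a b, ENNReal.ofReal C :=
        setLIntegral_mono measurable_const fun t ht =>
          ENNReal.ofReal_le_ofReal ((Real.sqrt_le_left hC).2 (h t ht))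
    _ = ENNReal.ofReal (C * (b - a)) := by
        rw [setLIntegral_const, Real.volume_Ioo, ENNReal.ofReal_mul hC]

theorem exists_path_of_inducedEDist_lt (hf : IsSpacelikeImmersion Q f) {x y : S} {r : ENNReal}
    (h : inducedEDist Q f x y < r) :
    ∃ γ : ℝ → S, γ 0 = x ∧ γ 1 = y ∧ ContMDiffOn 𝓘(ℝ, ℝ) (𝓡 2) 1 γ (Icc 0 1) ∧
      ∫⁻ t in Ioo 0 1, ENNReal.ofReal √(Q (deriv (fun r => (f (γ r) : E)) t)) < r := by
  let : ∀ s : S, ENorm (TangentSpace (𝓡 2) s) := formENorm Q f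
  obtain ⟨γ, h0, h1, hγ, hlength⟩ := Manifold.exists_lt_of_riemannianEDist_lt h
  exact ⟨γ, h0, h1, hγ, (hf.pathELength_eq hγ).symm.trans_lt hlength⟩

end IsSpacelikeImmersion

end Length

end Surface

/-! ### Convergence for the induced distance -/

section InducedDistance

open MeasureTheory Set Filter

theorem exists_last_notMem {X : Type*} [TopologicalSpace X] {γ : ℝ → X} {a b : ℝ} (hab : a ≤ b)
    (hγ : ContinuousOn γ (Icc a b)) {O : Set X} (hO : IsOpen O) (ha : γ a ∉ O) (hb : γ b ∈ O) :
    ∃ τ ∈ Ico a b, γ τ ∈ frontier O ∧ ∀ t ∈ Ioc τ b, γ t ∈ O := by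
  have hZ : IsCompact (Icc a b ∩ γ ⁻¹' Oᶜ) := isCompact_Icc.of_isClosed_subset
    (hγ.preimage_isClosed_of_isClosed isClosed_Icc hO.isClosed_compl) inter_subset_left
  obtain ⟨τ, ⟨hτ, hτO⟩, hmax⟩ := hZ.exists_isGreatest ⟨a, left_mem_Icc.2 hab, ha⟩
  have hτb : τ < b := hτ.2.lt_of_ne fun h => hτO (h ▸ hb)
  have hin : ∀ t ∈ Ioc τ b, γ t ∈ O := by
    intro t ht
    by_contra htO
    exact absurd (hmax ⟨⟨hτ.1.trans ht.1.le, ht.2⟩, htO⟩) (not_le.2 ht.1)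
  refine ⟨τ, ⟨hτ.1, hτb⟩, hO.frontier_eq ▸ ⟨?_, hτO⟩, hin⟩
  refine ((hγ τ hτ).mono fun t ht => ⟨hτ.1.trans ht.1.le, ht.2⟩).mem_closure ?_ hin
  rw [closure_Ioc hτb.ne]
  exact left_mem_Icc.2 hτb.le

variable {S : Type*} [TopologicalSpace S] [ChartedSpace (EuclideanSpace ℝ (Fin 2)) S]
  {f : S → PseudoHyp Q} {A : E →L[ℝ] ModelPlane}

namespace LocalParam

variable {s : S} (p : LocalParam Q f s)

theorem exists_pos_mul_norm_sq_le [FiniteDimensional ℝ E] {K : Set ModelPlane} (hK : IsCompact K)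
    (hKt : K ⊆ p.chart.target) :
    ∃ c : ℝ, 0 < c ∧ ∀ y ∈ K, ∀ ξ : ModelPlane, (c * ‖ξ‖) ^ 2 ≤ Q (fderiv ℝ p.map y ξ) := by
  have hcont : ContinuousOn (fun z : ModelPlane × ModelPlane => Q (fderiv ℝ p.map z.1 z.2))
      (K ×ˢ Metric.sphere (0 : ModelPlane) 1) := by
    have hder : ContinuousOn (fderiv ℝ p.map) K := fun y hy =>
      ((p.contDiffAt y (hKt hy)).continuousAt_fderiv (by simp)).continuousWithinAt
    exact (continuous_form Q).comp_continuousOn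
      ((hder.comp continuousOn_fst fun z hz => hz.1).clm_apply continuousOn_snd)
  obtain ⟨c, hc, hle⟩ :=
    (hK.prod (isCompact_sphere (0 : ModelPlane) 1)).exists_forall_le' hcont (a := 0)
      fun z hz => p.pos z.1 (hKt hz.1) z.2 (ne_zero_of_mem_unit_sphere ⟨z.2, hz.2⟩)
  refine ⟨√c, Real.sqrt_pos.2 hc, fun y hy ξ => ?_⟩
  rw [mul_pow, Real.sq_sqrt hc.le]
  rcases eq_or_ne ξ 0 with rfl | hξ
  · simp
  · have hn : ‖ξ‖ ≠ 0 := norm_ne_zero_iff.2 hξ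
    have hunit := hle (y, ‖ξ‖⁻¹ • ξ) ⟨hy, by simp [norm_smul, hn]⟩
    simp only [map_smul, form_smul] at hunit
    rwa [inv_pow, inv_mul_eq_div, le_div_iff₀ (by positivity)] at hunit

variable {c : ℝ} {γ : ℝ → S}

theorem enorm_deriv_le (hp : ∀ t ∈ p.chart.source, p.chart t = A (f t)) (hc : 0 < c) {t : ℝ}
    (hγ : ContinuousAt γ t) (hfγ : DifferentiableAt ℝ (fun r => (f (γ r) : E)) t)
    (ht : γ t ∈ p.chart.source)
    (hle : ∀ ξ, (c * ‖ξ‖) ^ 2 ≤ Q (fderiv ℝ p.map (p.chart (γ t)) ξ)) :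
    ‖deriv (fun r => A (f (γ r))) t‖ₑ ≤
      ENNReal.ofReal c⁻¹ * ENNReal.ofReal √(Q (deriv (fun r => (f (γ r) : E)) t)) := by
  have hA : HasDerivAt (fun r => A (f (γ r))) (A (deriv (fun r => (f (γ r) : E)) t)) t :=
    A.hasFDerivAt.comp_hasDerivAt t hfγ.hasDerivAt
  have hmap : HasFDerivAt p.map (fderiv ℝ p.map (A (f (γ t)))) (A (f (γ t))) := by
    rw [← hp _ ht]
    exact ((p.contDiffAt _ (p.chart.map_source ht)).differentiableAt (by simp)).hasFDerivAt
  have hev : (fun r => (f (γ r) : E)) =ᶠ[𝓝 t] p.map ∘ fun r => A (f (γ r)) := by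
    filter_upwards [hγ.preimage_mem_nhds (p.chart.open_source.mem_nhds ht)] with r hr
    rw [Function.comp_apply, ← hp _ hr, map, p.chart.left_inv hr]
  have hQ := hle (A (deriv (fun r => (f (γ r) : E)) t))
  rw [hp _ ht, ← (hmap.comp_hasDerivAt t hA).deriv, ← hev.deriv_eq] at hQ
  rw [hA.deriv, ← ofReal_norm, ← ENNReal.ofReal_mul (by positivity)]
  refine ENNReal.ofReal_le_ofReal ?_
  rw [inv_mul_eq_div, le_div_iff₀ hc, mul_comm]
  exact Real.le_sqrt_of_sq_le hQ

theorem enorm_sub_le_lintegral (hf : IsSpacelikeImmersion Q f)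
    (hp : ∀ t ∈ p.chart.source, p.chart t = A (f t)) (hc : 0 < c) {K : Set ModelPlane}
    (hle : ∀ y ∈ K, ∀ ξ : ModelPlane, (c * ‖ξ‖) ^ 2 ≤ Q (fderiv ℝ p.map y ξ)) {a b : ℝ}
    (hab : a ≤ b) (hγ : ContMDiffOn 𝓘(ℝ, ℝ) (𝓡 2) 1 γ (Icc a b))
    (hmem : ∀ t ∈ Ioo a b, γ t ∈ p.chart.source ∩ p.chart ⁻¹' K) :
    ‖A (f (γ b)) - A (f (γ a))‖ₑ ≤ ENNReal.ofReal c⁻¹ *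
      ∫⁻ t in Ioo a b, ENNReal.ofReal √(Q (deriv (fun r => (f (γ r) : E)) t)) := by
  have hfγ : ContDiffOn ℝ 1 (fun t => (f (γ t) : E)) (Icc a b) := by
    rw [← contMDiffOn_iff_contDiffOn]
    exact (hf.1.of_le (by simp)).comp_contMDiffOn hγ
  refine (enorm_sub_le_lintegral_deriv_of_contDiffOn_Icc
    (A.contDiff.comp_contDiffOn hfγ) hab).trans ?_
  rw [← restrict_Ioo_eq_restrict_Icc, ← lintegral_const_mul' _ _ ENNReal.ofReal_ne_top]
  refine setLIntegral_mono' measurableSet_Ioo fun t ht => ?_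
  have hnhds := Icc_mem_nhds ht.1 ht.2
  exact p.enorm_deriv_le hp hc (hγ.continuousOn.continuousAt hnhds)
    ((hfγ.contDiffAt hnhds).differentiableAt (by simp)) (hmem t ht).1 (hle _ (hmem t ht).2)

end LocalParam

namespace IsSpacelikeImmersion

variable [FiniteDimensional ℝ E] [T2Space S] [IsManifold (𝓡 2) ∞ S]

/-- A path of small length ending at `x` cannot leave a small graph chart around `x`: otherwise the
part of it after its last exit time would already be too long. -/
theorem exists_forall_inducedEDist_lt_mem (hf : IsSpacelikeImmersion Q f)
    (hA : ∀ x, Q x ≤ ‖A x‖ ^ 2) {x : S} {N : Set S} (hN : N ∈ 𝓝 x) :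
    ∃ r : ENNReal, 0 < r ∧ ∀ y, inducedEDist Q f y x < r → y ∈ N := by
  obtain ⟨p, hp⟩ := hf.exists_graphParam hA x
  have hN' : p.chart.symm ⁻¹' N ∩ p.chart.target ∈ 𝓝 (p.chart x) :=
    inter_mem ((p.chart.continuousAt_symm p.mem_target).preimage_mem_nhds
      ((p.chart.left_inv p.mem_source).symm ▸ hN)) (p.chart.open_target.mem_nhds p.mem_target)
  obtain ⟨ρ, hρ, hball⟩ := Metric.nhds_basis_closedBall.mem_iff.1 hN'
  let B := Metric.closedBall (p.chart x) ρ
  have hBt : B ⊆ p.chart.target := fun y hy => (hball hy).2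
  obtain ⟨c, hc, hle⟩ := p.exists_pos_mul_norm_sq_le (isCompact_closedBall (p.chart x) ρ) hBt
  let O : Set S := p.chart.source ∩ p.chart ⁻¹' Metric.ball (p.chart x) ρ
  have hO : IsOpen O := p.chart.isOpen_inter_preimage Metric.isOpen_ball
  have hclosure : closure O ⊆ p.chart.source ∩ p.chart ⁻¹' B := by
    refine closure_minimal (inter_subset_inter_right _
      (preimage_mono Metric.ball_subset_closedBall)) ?_
    rw [← p.chart.symm_image_eq_source_inter_preimage hBt]
    exact ((isCompact_closedBall _ _).image_of_continuousOn
      (p.chart.continuousOn_symm.mono hBt)).isClosed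
  have hON : O ⊆ N := fun z hz => by
    rw [← p.chart.left_inv hz.1]
    exact (hball (Metric.ball_subset_closedBall hz.2)).1
  refine ⟨ENNReal.ofReal (c * ρ), by simpa using mul_pos hc hρ, fun y hy => hON ?_⟩
  obtain ⟨γ, rfl, h1, hγ, hlength⟩ := hf.exists_path_of_inducedEDist_lt hy
  have hx : γ 1 ∈ O := h1 ▸ ⟨p.mem_source, Metric.mem_ball_self hρ⟩
  by_contra hy0
  obtain ⟨τ, hτ, hτO, hin⟩ := exists_last_notMem zero_le_one hγ.continuousOn hO hy0 hx
  have hlt : ‖A (f (γ 1)) - A (f (γ τ))‖ₑ < ENNReal.ofReal ρ := by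
    refine (p.enorm_sub_le_lintegral hf hp hc hle hτ.2.le
      (hγ.mono (Icc_subset_Icc_left hτ.1))
      fun t ht => hclosure (subset_closure (hin t ⟨ht.1, ht.2.le⟩))).trans_lt ?_
    rw [show ρ = c⁻¹ * (c * ρ) by field_simp, ENNReal.ofReal_mul (by positivity)]
    exact ENNReal.mul_lt_mul_right (by simpa using hc) ENNReal.ofReal_ne_top
      ((lintegral_mono_set (Ioo_subset_Ioo_left hτ.1)).trans_lt hlength)
  rw [hO.frontier_eq] at hτO
  refine hτO.2 ⟨(hclosure hτO.1).1, ?_⟩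
  rw [mem_preimage, Metric.mem_ball, hp _ (hclosure hτO.1).1, hp _ p.mem_source, dist_comm,
    dist_eq_norm, ← h1]
  rwa [← ofReal_norm, ENNReal.ofReal_lt_ofReal_iff hρ] at hlt

theorem tendsto_of_tendsto_inducedEDist (hf : IsSpacelikeImmersion Q f)
    (hA : ∀ x, Q x ≤ ‖A x‖ ^ 2) {ι : Type*} {l : Filter ι} {a : ι → S} {x : S}
    (h : Tendsto (fun i => inducedEDist Q f (a i) x) l (𝓝 0)) : Tendsto a l (𝓝 x) := by
  refine tendsto_def.2 fun N hN => ?_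
  obtain ⟨r, hr, hrN⟩ := hf.exists_forall_inducedEDist_lt_mem hA hN
  filter_upwards [h.eventually (gt_mem_nhds hr)] with i hi using hrN _ hi

end IsSpacelikeImmersion

end InducedDistance

/-! ### Convergence of lifts of segments -/

section Lift

open Set Filter

variable {S : Type*} [TopologicalSpace S] {f : S → PseudoHyp Q} {x : S} {T : ℝ} {g : ℝ → S}

section Complete

variable [ChartedSpace (EuclideanSpace ℝ (Fin 2)) S] [IsManifold (𝓡 2) ∞ S]
  {A : E →L[ℝ] ModelPlane} {v : ModelPlane}

namespace IsSpacelikeImmersion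

theorem contMDiffAt_of_isLiftOn (hf : IsSpacelikeImmersion Q f) (hA : ∀ x, Q x ≤ ‖A x‖ ^ 2)
    (hg : IsLiftOn (fun s => A (f s)) x v (Ico 0 T) g) {t : ℝ} (ht : t ∈ Ioo 0 T) :
    ContMDiffAt 𝓘(ℝ, ℝ) (𝓡 2) ∞ g t := by
  refine hf.contMDiffAt_lift hA (γ := fun t => A (f x) + t • v) ?_ ?_ (by fun_prop)
  · exact hg.continuousOn.continuousAt (Ico_mem_nhds ht.1 ht.2)
  · filter_upwards [Ioo_mem_nhds ht.1 ht.2] with r hr using hg.lift r ⟨hr.1.le, hr.2⟩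

theorem inducedEDist_le_of_isLiftOn (hf : IsSpacelikeImmersion Q f)
    (hA : ∀ x, Q x ≤ ‖A x‖ ^ 2) (hg : IsLiftOn (fun s => A (f s)) x v (Ico 0 T) g) {a b : ℝ}
    (ha : a ∈ Ioo 0 T) (hb : b ∈ Ioo 0 T) (hab : a ≤ b) :
    inducedEDist Q f (g a) (g b) ≤ ENNReal.ofReal (‖v‖ * (b - a)) := by
  have hsub : Icc a b ⊆ Ioo 0 T := fun t ht => ⟨ha.1.trans_le ht.1, ht.2.trans_lt hb.2⟩
  have hsmooth {t : ℝ} (ht : t ∈ Icc a b) := hf.contMDiffAt_of_isLiftOn hA hg (hsub ht)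
  refine hf.inducedEDist_le hab (fun t ht => ((hsmooth ht).of_le (by simp)).contMDiffWithinAt)
    (norm_nonneg v) fun t ht => ?_
  have hfg : DifferentiableAt ℝ (fun r => (f (g r) : E)) t :=
    ((hf.1.contMDiffAt (x := g t)).comp t
      (hsmooth (Ioo_subset_Icc_self ht))).contDiffAt.differentiableAt (by simp)
  have hder : HasDerivAt (fun r => A (f (g r))) (A (deriv (fun r => (f (g r) : E)) t)) t :=
    A.hasFDerivAt.comp_hasDerivAt t hfg.hasDerivAt
  have hder' : HasDerivAt (fun r => A (f (g r))) v t := by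
    have hline : HasDerivAt (fun r : ℝ => A (f x) + r • v) v t := by
      simpa using ((hasDerivAt_id t).smul_const v).const_add (A (f x))
    refine hline.congr_of_eventuallyEq ?_
    have ht' := hsub (Ioo_subset_Icc_self ht)
    filter_upwards [Ioo_mem_nhds ht'.1 ht'.2] with r hr using hg.lift r ⟨hr.1.le, hr.2⟩
  rw [hder'.unique hder]
  exact hA _

theorem exists_mapClusterPt_of_complete [FiniteDimensional ℝ E] [T2Space S]
    (hf : IsSpacelikeImmersion Q f) (hA : ∀ x, Q x ≤ ‖A x‖ ^ 2) (hcomplete : IsCompleteInduced Q f)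
    (hT : 0 < T) (hg : IsLiftOn (fun s => A (f s)) x v (Ico 0 T) g) :
    ∃ y, MapClusterPt y (𝓝[<] T) g := by
  obtain ⟨t, ht_mono, ht_mem, ht_lim⟩ := exists_seq_strictMono_tendsto' hT
  have hgap : Tendsto (fun k => ENNReal.ofReal (‖v‖ * (T - t k))) atTop (𝓝 0) := by
    simpa using ENNReal.tendsto_ofReal ((ht_lim.const_sub T).const_mul ‖v‖)
  obtain ⟨y, hy⟩ := hcomplete (fun k => g (t k)) fun ε hε => by
    obtain ⟨N, hN⟩ := (hgap.eventually (gt_mem_nhds hε)).exists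
    have hord (k) (hk : N ≤ k) (l) (hkl : k ≤ l) : inducedEDist Q f (g (t k)) (g (t l)) < ε := by
      refine ((hf.inducedEDist_le_of_isLiftOn hA hg (ht_mem k) (ht_mem l)
        (ht_mono.monotone hkl)).trans (ENNReal.ofReal_le_ofReal ?_)).trans_lt hN
      gcongr
      · exact (ht_mem l).2.le
      · exact ht_mono.monotone hk
    refine ⟨N, fun k hk l hl => ?_⟩
    rcases le_total k l with h | h
    · exact hord k hk l h
    · rw [inducedEDist_comm]
      exact hord l hl k h
  have hconv := hf.tendsto_of_tendsto_inducedEDist hA hy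
  have ht_lim' : Tendsto t atTop (𝓝[<] T) :=
    tendsto_nhdsWithin_iff.2 ⟨ht_lim, Eventually.of_forall fun k => (ht_mem k).2⟩
  exact ⟨y, (hconv.mapClusterPt : MapClusterPt y atTop (g ∘ t)).of_comp ht_lim'⟩

end IsSpacelikeImmersion

end Complete

section Proper

variable [FiniteDimensional ℝ E] {F G : Type*} [NormedAddCommGroup F] [NormedSpace ℝ F]
  [NormedAddCommGroup G] [NormedSpace ℝ G] {L : E ≃L[ℝ] F × G}

namespace IsSplitting

theorem isCompact_norm_fst_le (hL : IsSplitting Q L) (R : ℝ) :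
    IsCompact {y : PseudoHyp Q | ‖(L y).1‖ ≤ R} := by
  have : FiniteDimensional ℝ (F × G) := L.toLinearEquiv.finiteDimensional
  have : ProperSpace (F × G) := FiniteDimensional.proper ℝ (F × G)
  have hclosed : IsClosed (PseudoHyp Q) := isClosed_eq (continuous_form Q) continuous_const
  refine ((L.toHomeomorph.isClosedEmbedding.comp
    hclosed.isClosedEmbedding_subtypeVal).isCompact_preimage
      (isCompact_closedBall (0 : F × G) (R + 1))).of_isClosed_subset ?_ fun y hy => ?_
  · exact isClosed_le (by fun_prop) continuous_const
  · have hy' : ‖(L y).1‖ ≤ R := hy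
    have hform : ‖(L y).1‖ ^ 2 - ‖(L y).2‖ ^ 2 = -1 := (hL y).symm.trans y.2
    have hsnd : ‖(L y).2‖ ≤ R + 1 := by nlinarith [norm_nonneg (L y).1, norm_nonneg (L y).2]
    exact mem_closedBall_zero_iff.2 (max_le (hy'.trans (by linarith)) hsnd)

theorem exists_mapClusterPt_of_proper (hL : IsSplitting Q L) (hproper : IsProperMap f) (hT : 0 < T)
    {v : F} (hg : IsLiftOn (fun s => (L (f s)).1) x v (Ico 0 T) g) :
    ∃ y, MapClusterPt y (𝓝[<] T) g := by
  have hbound (t) (ht : t ∈ Ico 0 T) : ‖(L (f (g t))).1‖ ≤ ‖(L (f x)).1‖ + T * ‖v‖ := by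
    have hlift : (L (f (g t))).1 = (L (f x)).1 + t • v := hg.lift t ht
    rw [hlift]
    refine norm_add_le_of_le le_rfl ?_
    rw [norm_smul, Real.norm_of_nonneg ht.1]
    exact mul_le_mul_of_nonneg_right ht.2.le (norm_nonneg v)
  obtain ⟨y, -, hy⟩ := (hproper.isCompact_preimage (hL.isCompact_norm_fst_le _)).exists_mapClusterPt
    (f := 𝓝[<] T) (u := g) <| le_principal_iff.2 <| mem_map.2 <| by
      filter_upwards [Ico_mem_nhdsLT hT] with t ht using hbound t ht
  exact ⟨y, hy⟩

end IsSplitting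

end Proper

end Lift

/-! ### Entire graphs -/

section Graph

variable {S : Type*} [TopologicalSpace S] [ChartedSpace (EuclideanSpace ℝ (Fin 2)) S]
  [IsManifold (𝓡 2) ∞ S] {f : S → PseudoHyp Q}

theorem IsSpacelikeImmersion.exists_contMDiff_inverse (hf : IsSpacelikeImmersion Q f)
    {A : E →L[ℝ] ModelPlane} (hA : ∀ x, Q x ≤ ‖A x‖ ^ 2)
    (hbij : Function.Bijective fun s => A (f s)) :
    ∃ σ : ModelPlane → S, ContMDiff 𝓘(ℝ, ModelPlane) (𝓡 2) ∞ σ ∧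
      (∀ s, σ (A (f s)) = s) ∧ ∀ v, A (f (σ v)) = v := by
  let h := (hf.isLocalHomeomorph hA).toHomeomorphOfBijective hbij
  have hright (v : ModelPlane) : A (f (h.symm v)) = v := h.apply_symm_apply v
  exact ⟨h.symm, fun v => hf.contMDiffAt_lift hA (γ := id) h.symm.continuous.continuousAt
    (Filter.Eventually.of_forall hright) contDiffAt_id, h.symm_apply_apply, hright⟩

variable [FiniteDimensional ℝ E]

theorem PointedPlane.contDiff_warpedProj (P : PointedPlane Q) : ContDiff ℝ ∞ P.warpedProj := by
  have hproj : ContDiff ℝ ∞ P.projU := (LinearMap.toContinuousLinearMap P.projU).contDiff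
  simp only [funext P.warpedProj_eq]
  refine hproj.add (ContDiff.smul (ContDiff.sqrt (contDiff_const.add
    ((contDiff_form Q).comp hproj)) fun x => ?_) contDiff_const)
  have := P.nonneg_of_mem_U (P.projU_mem x)
  positivity

variable {G : Type*} [NormedAddCommGroup G] [NormedSpace ℝ G] {L : E ≃L[ℝ] ModelPlane × G}

theorem IsSpacelikeImmersion.isDiffeoOnto_of_bijective (hf : IsSpacelikeImmersion Q f)
    (P : PointedPlane Q) (hL : IsSplitting Q L) (hP : ∀ x, P.projU x = L.symm ((L x).1, 0))
    (hbij : Function.Bijective fun s => (L (f s)).1) :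
    IsDiffeoOnto (fun s => P.warpedProj (f s : E)) P.plane := by
  let A := (ContinuousLinearMap.fst ℝ ModelPlane G).comp (L : E →L[ℝ] ModelPlane × G)
  obtain ⟨σ, hσ, hσ_left, hσ_right⟩ :=
    hf.exists_contMDiff_inverse (A := A) hL.form_le_norm_fst_sq hbij
  have hA (x : E) : A (P.projU x) = A x := by
    change (L (P.projU x)).1 = (L x).1
    rw [hP, L.apply_symm_apply]
  refine ⟨P.contDiff_warpedProj.contMDiff.comp hf.1,
    fun s => P.mem_plane_iff.2 ⟨_, P.projU_mem _, P.warpedProj_eq _⟩, fun x => σ (A x),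
    (hσ.comp A.contDiff.contMDiff).contMDiffOn, fun s => ?_, fun x hx => ?_⟩
  · change σ (A (P.warpedProj (f s))) = s
    rw [← hA, P.projU_warpedProj, hA, hσ_left]
  · obtain ⟨u, hu, rfl⟩ := P.mem_plane_iff.1 hx
    set x := u + √(1 + Q u) • P.q
    have hx : P.projU x = u := by
      rw [map_add, map_smul, P.projU_q, P.projU_of_mem_U hu, smul_zero, add_zero]
    have hu : P.projU (f (σ (A x))) = u := by
      have hfst : (L (f (σ (A x)))).1 = (L x).1 := hσ_right (A x)
      rw [hP, hfst, ← hP, hx]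
    change P.warpedProj (f (σ (A x))) = x
    rw [P.warpedProj_eq, hu]

theorem IsSpacelikeImmersion.isEntireGraph {m : ℕ} (hQ : HasSignature Q ⊤ 2 m) [T2Space S]
    [ConnectedSpace S] (hf : IsSpacelikeImmersion Q f)
    (h : IsProperMap f ∨ IsCompleteInduced Q f) : IsEntireGraph Q f := by
  intro P
  obtain ⟨L, hL, hP⟩ := P.exists_isSplitting hQ
  let A := (ContinuousLinearMap.fst ℝ _ _).comp (L : E →L[ℝ] ModelPlane × EuclideanSpace ℝ (Fin m))
  have hA : ∀ x, Q x ≤ ‖A x‖ ^ 2 := hL.form_le_norm_fst_sq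
  refine hf.isDiffeoOnto_of_bijective P hL hP
    (bijective_of_lifts (hf.isLocalHomeomorph hA) fun x v T hT g hg => ?_)
  rcases h with h | h
  · exact hL.exists_mapClusterPt_of_proper h hT.1 hg
  · exact hf.exists_mapClusterPt_of_complete hA h hT.1 hg

end Graph

/-! ### The space of rays -/

section Ray

open Set

theorem continuous_rayOfNeZero :
    Continuous fun v : {v : E // v ≠ 0} => rayOfNeZero ℝ v.1 v.2 := continuous_coinduced_rng

/-- The unit vector of a ray, which realizes the space of rays as the unit sphere. -/
def rayUnit (r : Module.Ray ℝ E) : E := ‖r.someVector‖⁻¹ • r.someVector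

theorem rayUnit_rayOfNeZero {v : E} (hv : v ≠ 0) : rayUnit (rayOfNeZero ℝ v hv) = ‖v‖⁻¹ • v := by
  refine SameRay.inv_norm_smul_eq (Module.Ray.someVector_ne_zero _) hv ?_
  rw [← ray_eq_iff (Module.Ray.someVector_ne_zero _) hv]
  exact Module.Ray.someVector_ray _

theorem continuous_rayUnit : Continuous (rayUnit : Module.Ray ℝ E → E) := by
  refine continuous_coinduced_dom.2 ?_
  simp only [Function.comp_def, rayUnit_rayOfNeZero]
  exact (continuous_subtype_val.norm.inv₀ fun v => norm_ne_zero_iff.2 v.2).smul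
    continuous_subtype_val

theorem rayUnit_injective : Function.Injective (rayUnit : Module.Ray ℝ E → E) := by
  intro r r' h
  induction r using Module.Ray.ind with | h v hv => ?_
  induction r' using Module.Ray.ind with | h w hw => ?_
  rw [rayUnit_rayOfNeZero, rayUnit_rayOfNeZero] at h
  exact (ray_eq_iff hv hw).2 ((sameRay_iff_inv_norm_smul_eq_of_ne hv hw).2 h)

instance rayT2Space : T2Space (Module.Ray ℝ E) :=
  T2Space.of_injective_continuous rayUnit_injective continuous_rayUnit

theorem exists_pos_smul_eq_of_rayOfNeZero_eq {v w : E} {hv : v ≠ 0} {hw : w ≠ 0}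
    (h : rayOfNeZero ℝ v hv = rayOfNeZero ℝ w hw) : ∃ c : ℝ, 0 < c ∧ c • v = w :=
  ((ray_eq_iff hv hw).1 h).exists_pos_left hv hw

theorem raySpan_image {ι : Type*} (v : ι → E) (hv : ∀ i, v i ≠ 0) (A : Set ι) :
    raySpan ((fun i => rayOfNeZero ℝ (v i) (hv i)) '' A) = Submodule.span ℝ (v '' A) := by
  apply le_antisymm <;> refine Submodule.span_le.2 ?_
  · rintro _ ⟨hw, i, hi, h⟩
    obtain ⟨r, -, rfl⟩ := exists_pos_smul_eq_of_rayOfNeZero_eq h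
    exact Submodule.smul_mem _ _ (Submodule.subset_span (mem_image_of_mem v hi))
  · rintro _ ⟨i, hi, rfl⟩
    exact Submodule.subset_span ⟨hv i, mem_image_of_mem _ hi⟩

theorem rayOfNeZero_mem_infinity_iff {v : E} (hv : v ≠ 0) :
    rayOfNeZero ℝ v hv ∈ infinity Q ↔ Q v = 0 := by
  refine ⟨?_, fun h => ⟨v, hv, h, rfl⟩⟩
  rintro ⟨w, hw, hQ, h⟩
  obtain ⟨c, hc, rfl⟩ := exists_pos_smul_eq_of_rayOfNeZero_eq h
  rw [form_smul] at hQ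
  exact (mul_eq_zero.1 hQ).resolve_left (by positivity)

theorem toRay_notMem_infinity (x : PseudoHyp Q) : toRay Q x ∉ infinity Q := by
  have hx : Q (x : E) = -1 := x.2
  rw [toRay, rayOfNeZero_mem_infinity_iff, hx]
  norm_num

end Ray

/-! ### Triples of isotropic vectors -/

section Triple

variable {a b c : E}

/-- A plane in the span of three vectors, positive definite when these vectors are isotropic with
negative pairwise products. -/
def triplePlane (Q : QuadraticForm ℝ E) (a b c : E) : (ℝ × ℝ) →ₗ[ℝ] E :=
  LinearMap.coprod
    (LinearMap.toSpanSingleton ℝ E (scal Q b c • a - scal Q a c • b))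
    (LinearMap.toSpanSingleton ℝ E (scal Q a c • b - scal Q a b • c))

theorem triplePlane_mem (x : ℝ × ℝ) : triplePlane Q a b c x ∈ Submodule.span ℝ {a, b, c} := by
  have ha : a ∈ Submodule.span ℝ {a, b, c} := Submodule.subset_span (by simp)
  have hb : b ∈ Submodule.span ℝ {a, b, c} := Submodule.subset_span (by simp)
  have hc : c ∈ Submodule.span ℝ {a, b, c} := Submodule.subset_span (by simp)
  exact add_mem
    (Submodule.smul_mem _ _ (sub_mem (Submodule.smul_mem _ _ ha) (Submodule.smul_mem _ _ hb)))
    (Submodule.smul_mem _ _ (sub_mem (Submodule.smul_mem _ _ hb) (Submodule.smul_mem _ _ hc)))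

theorem form_triplePlane (ha : Q a = 0) (hb : Q b = 0) (hc : Q c = 0) (x : ℝ × ℝ) :
    Q (triplePlane Q a b c x) =
      -(2 * (scal Q a b * scal Q a c * scal Q b c)) * (x.1 ^ 2 - x.1 * x.2 + x.2 ^ 2) := by
  simp only [triplePlane, LinearMap.coprod_apply, LinearMap.toSpanSingleton_apply,
    form_smul_add_smul, form_sub, form_smul, map_sub, map_smul, LinearMap.sub_apply,
    LinearMap.smul_apply, smul_eq_mul, scal_self, ha, hb, hc]
  ring

theorem triplePlane_pos (ha : Q a = 0) (hb : Q b = 0) (hc : Q c = 0) (hab : scal Q a b < 0)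
    (hac : scal Q a c < 0) (hbc : scal Q b c < 0) {x : ℝ × ℝ} (hx : x ≠ 0) :
    0 < Q (triplePlane Q a b c x) := by
  rw [form_triplePlane ha hb hc]
  have hprod : scal Q a b * scal Q a c * scal Q b c < 0 :=
    mul_neg_of_pos_of_neg (mul_pos_of_neg_of_neg hab hac) hbc
  have hsq : 0 < x.1 ^ 2 + x.2 ^ 2 := by
    rcases not_and_or.1 (mt Prod.ext_iff.2 hx) with h | h
    · exact add_pos_of_pos_of_nonneg (sq_pos_of_ne_zero h) (sq_nonneg _)
    · exact add_pos_of_nonneg_of_pos (sq_nonneg _) (sq_pos_of_ne_zero h)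
  exact mul_pos (by linarith) (by nlinarith [sq_nonneg (x.1 - x.2)])

variable [FiniteDimensional ℝ E]

theorem hasSignature_two_one (ha : Q a = 0) (hb : Q b = 0) (hc : Q c = 0) (hab : scal Q a b < 0)
    (hac : scal Q a c < 0) (hbc : scal Q b c < 0) :
    HasSignature Q (Submodule.span ℝ {a, b, c}) 2 1 := by
  classical
  refine hasSignature_of_forall_pos_of_forall_neg ?_ (triplePlane Q a b c) triplePlane_mem (by simp)
    (fun x hx => triplePlane_pos ha hb hc hab hac hbc hx)
    (LinearMap.toSpanSingleton ℝ E (a + b)) (fun r => ?_) (by simp) (fun r hr => ?_)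
  · have hcard := finrank_span_finset_le_card (R := ℝ) {a, b, c}
    rw [Finset.coe_insert, Finset.coe_pair] at hcard
    exact hcard.trans Finset.card_le_three
  · exact Submodule.smul_mem _ _ (add_mem (Submodule.subset_span (by simp))
      (Submodule.subset_span (by simp)))
  · rw [LinearMap.toSpanSingleton_apply, form_smul, form_add, ha, hb]
    exact mul_neg_of_pos_of_neg (by positivity) (by linarith)

theorem HasSignature.scal_ne_zero (h : HasSignature Q (Submodule.span ℝ {c, a, b}) 1 2)
    (ha : Q a = 0) (hb : Q b = 0) : scal Q a b ≠ 0 := by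
  intro hab
  have hpair : Module.finrank ℝ (Submodule.span ℝ {a, b}) ≤ 1 := by
    refine h.finrank_le_of_nonneg (Submodule.span_mono (Set.subset_insert _ _)) fun x hx => ?_
    obtain ⟨r, s, rfl⟩ := Submodule.mem_span_pair.1 hx
    simp [form_smul_add_smul, ha, hb, hab]
  have hadd := Submodule.finrank_add_le_finrank_add_finrank
    (Submodule.span ℝ {c}) (Submodule.span ℝ {a, b})
  rw [← Submodule.span_insert, h.1] at hadd
  have hsingleton : Module.finrank ℝ (Submodule.span ℝ {c}) ≤ 1 := by
    simpa using finrank_span_le_card (R := ℝ) {c}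
  omega

theorem not_hasSignature_one_two (ha : Q a = 0) (hb : Q b = 0) (hc : Q c = 0)
    (hab : scal Q a b ≤ 0) (hac : scal Q a c ≤ 0) (hbc : scal Q b c ≤ 0) :
    ¬ HasSignature Q (Submodule.span ℝ {a, b, c}) 1 2 := by
  intro h
  have hbc' : scal Q b c < 0 := hbc.lt_of_ne (h.scal_ne_zero hb hc)
  have hac' : scal Q a c < 0 := hac.lt_of_ne
    (HasSignature.scal_ne_zero (c := b) (by rwa [Set.insert_comm]) ha hc)
  have hab' : scal Q a b < 0 := hab.lt_of_ne
    (HasSignature.scal_ne_zero (c := c) (by rwa [Set.insert_comm, Set.pair_comm c b]) ha hb)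
  have hone := h.2.1
  rw [(hasSignature_two_one ha hb hc hab' hac' hbc').2.1] at hone
  norm_num at hone

end Triple

/-! ### The closure of an entire graph -/

section Hull

open Set

variable {S F G : Type*} [NormedAddCommGroup F] [NormedSpace ℝ F] [NormedAddCommGroup G]
  [NormedSpace ℝ G] (L : E ≃L[ℝ] F × G) (f : S → PseudoHyp Q)

/-- In a splitting `L`, the image of `f` is an acausal graph over the positive definite factor, and
no isotropic vector is orthogonal to it. -/
structure IsAcausalGraph : Prop where
  isSplitting : IsSplitting Q L
  scal_le : ∀ s t, scal Q (f s : E) (f t) ≤ -1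
  exists_fst_eq : ∀ u, ∃ s, (L (f s)).1 = u
  exists_scal_ne_zero : ∀ g : E, g ≠ 0 → Q g = 0 → ∃ s, scal Q g (f s) ≠ 0

/-- The representative of the ray of `f s` in the product of the unit disk and the unit sphere. -/
def unitPoint (s : S) : E := ‖(L (f s)).2‖⁻¹ • (f s : E)

/-- The closure of the graph in the product of the closed unit disk and the unit sphere. -/
def hull : Set E := closure (range (unitPoint L f))

/-- The isotropic part of the hull: the representatives of the asymptotic boundary. -/
def limitSet : Set E := hull L f ∩ {g | Q g = 0}

variable {L f}

theorem unitPoint_mem_hull (s : S) : unitPoint L f s ∈ hull L f := subset_closure (mem_range_self s)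

theorem form_unitPoint (s : S) : Q (unitPoint L f s) = -‖(L (f s)).2‖⁻¹ ^ 2 := by
  rw [unitPoint, form_smul, show Q (f s : E) = -1 from (f s).2, mul_neg_one]

theorem form_nonpos_of_mem_hull [FiniteDimensional ℝ E] {g : E} (hg : g ∈ hull L f) : Q g ≤ 0 := by
  refine closure_minimal ?_ (isClosed_le (continuous_form Q) continuous_const) hg
  rintro _ ⟨s, rfl⟩
  exact (form_unitPoint s).trans_le (neg_nonpos.2 (sq_nonneg _))

namespace IsAcausalGraph

variable (h : IsAcausalGraph L f)
include h

theorem norm_snd_sq (s : S) : ‖(L (f s)).2‖ ^ 2 = 1 + ‖(L (f s)).1‖ ^ 2 := by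
  have hQ : Q (f s : E) = -1 := (f s).2
  rw [h.isSplitting] at hQ
  linarith

theorem norm_snd_pos (s : S) : 0 < ‖(L (f s)).2‖ := by
  have hsq := h.norm_snd_sq s
  exact (norm_nonneg _).lt_of_ne' fun h0 => by nlinarith [sq_nonneg ‖(L (f s)).1‖]

theorem norm_snd_of_mem_hull {g : E} (hg : g ∈ hull L f) : ‖(L g).2‖ = 1 := by
  have hclosed : IsClosed {g : E | ‖(L g).2‖ = 1} := isClosed_eq (by fun_prop) continuous_const
  refine closure_minimal ?_ hclosed hg
  rintro _ ⟨s, rfl⟩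
  change ‖(L (unitPoint L f s)).2‖ = 1
  rw [unitPoint, map_smul, Prod.smul_snd, norm_smul, norm_inv, norm_norm]
  exact inv_mul_cancel₀ (h.norm_snd_pos s).ne'

theorem form_of_mem_hull {g : E} (hg : g ∈ hull L f) : Q g = ‖(L g).1‖ ^ 2 - 1 := by
  rw [h.isSplitting, h.norm_snd_of_mem_hull hg, one_pow]

theorem ne_zero_of_mem_hull {g : E} (hg : g ∈ hull L f) : g ≠ 0 := by
  rintro rfl
  simpa using h.norm_snd_of_mem_hull hg

theorem norm_fst_of_mem_limitSet {g : E} (hg : g ∈ limitSet L f) : ‖(L g).1‖ = 1 := by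
  have hQ := h.form_of_mem_hull hg.1
  rw [show Q g = 0 from hg.2] at hQ
  exact (pow_eq_one_iff_of_nonneg (norm_nonneg _) two_ne_zero).1 (by linarith)

theorem ball_subset_image_hull : Metric.ball 0 1 ⊆ (fun g => (L g).1) '' hull L f := by
  intro u hu
  have hu1 : 0 < 1 - ‖u‖ ^ 2 := sub_pos.2
    (pow_lt_one₀ (norm_nonneg u) (mem_ball_zero_iff.1 hu) two_ne_zero)
  have hsqrt := Real.sqrt_pos.2 hu1
  obtain ⟨s, hs⟩ := h.exists_fst_eq ((√(1 - ‖u‖ ^ 2))⁻¹ • u)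
  have hnorm : ‖(L (f s)).2‖ = (√(1 - ‖u‖ ^ 2))⁻¹ := by
    rw [← pow_left_inj₀ (norm_nonneg _) (by positivity) two_ne_zero, h.norm_snd_sq, hs, norm_smul,
      norm_inv, Real.norm_of_nonneg hsqrt.le, mul_pow, inv_pow, Real.sq_sqrt hu1.le]
    field_simp
    ring
  refine ⟨_, unitPoint_mem_hull s, ?_⟩
  change (L (unitPoint L f s)).1 = u
  rw [unitPoint, map_smul, Prod.smul_fst, hs, hnorm, inv_inv, smul_inv_smul₀ hsqrt.ne']

variable [FiniteDimensional ℝ E]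

theorem scal_le_of_mem_hull {g g' : E} (hg : g ∈ hull L f) (hg' : g' ∈ hull L f) :
    scal Q g g' ≤ -(√(-Q g) * √(-Q g')) := by
  have hclosed : IsClosed {p : E × E | scal Q p.1 p.2 ≤ -(√(-Q p.1) * √(-Q p.2))} := by
    have hQ := continuous_form Q
    exact isClosed_le (continuous_scal continuous_fst continuous_snd)
      ((hQ.comp continuous_fst).neg.sqrt.mul (hQ.comp continuous_snd).neg.sqrt).neg
  have hsub : range (unitPoint L f) ×ˢ range (unitPoint L f) ⊆
      {p : E × E | scal Q p.1 p.2 ≤ -(√(-Q p.1) * √(-Q p.2))} := by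
    rintro ⟨_, _⟩ ⟨⟨s, rfl⟩, ⟨t, rfl⟩⟩
    have hs := inv_pos.2 (h.norm_snd_pos s)
    have ht := inv_pos.2 (h.norm_snd_pos t)
    simp only [mem_ofPred_eq, form_unitPoint, neg_neg, Real.sqrt_sq hs.le, Real.sqrt_sq ht.le]
    simp only [unitPoint, map_smul, LinearMap.smul_apply, smul_eq_mul]
    nlinarith [mul_pos hs ht, h.scal_le s t]
  have hmem : (g, g') ∈ closure (range (unitPoint L f) ×ˢ range (unitPoint L f)) := by
    rw [closure_prod_eq]
    exact ⟨hg, hg'⟩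
  have hle := closure_minimal hsub hclosed hmem
  rwa [mem_ofPred_eq] at hle

theorem scal_apply_nonpos_of_mem_hull {g : E} (hg : g ∈ hull L f) (s : S) :
    scal Q g (f s) ≤ 0 := by
  have hle : scal Q g (unitPoint L f s) ≤ 0 :=
    (h.scal_le_of_mem_hull hg (unitPoint_mem_hull s)).trans (neg_nonpos.2 (by positivity))
  rw [unitPoint, map_smul, smul_eq_mul] at hle
  exact nonpos_of_mul_nonpos_right hle (inv_pos.2 (h.norm_snd_pos s))

theorem injOn_hull : InjOn (fun g => (L g).1) (hull L f) := by
  intro g hg g' hg' heq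
  have hfst : (L g).1 = (L g').1 := heq
  have hQ : Q g = Q g' := by rw [h.form_of_mem_hull hg, h.form_of_mem_hull hg', hfst]
  have hscal := h.scal_le_of_mem_hull hg hg'
  rw [hQ, Real.mul_self_sqrt (neg_nonneg.2 (form_nonpos_of_mem_hull hg'))] at hscal
  refine sub_eq_zero.1 (h.isSplitting.eq_zero_of_fst_eq_zero ?_ ?_)
  · rw [map_sub, Prod.fst_sub, hfst, sub_self]
  · rw [form_sub, hQ]
    linarith

theorem isCompact_hull : IsCompact (hull L f) := by
  have : FiniteDimensional ℝ (F × G) := L.toLinearEquiv.finiteDimensional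
  have : ProperSpace (F × G) := FiniteDimensional.proper ℝ (F × G)
  refine (L.toHomeomorph.isCompact_preimage.2
    (isCompact_closedBall (0 : F × G) 1)).of_isClosed_subset isClosed_closure fun g hg => ?_
  have hQ := h.form_of_mem_hull hg
  refine mem_closedBall_zero_iff.2 (max_le ?_ (h.norm_snd_of_mem_hull hg).le)
  change ‖(L g).1‖ ≤ 1
  exact (sq_le_one_iff₀ (norm_nonneg _)).1 (by linarith [form_nonpos_of_mem_hull hg])

theorem exists_mem_hull {u : F} (hu : ‖u‖ ≤ 1) : ∃ g ∈ hull L f, (L g).1 = u := by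
  have hclosed : IsClosed ((fun g => (L g).1) '' hull L f) :=
    (h.isCompact_hull.image (by fun_prop)).isClosed
  have hsub := closure_minimal h.ball_subset_image_hull hclosed
  rw [closure_ball _ one_ne_zero] at hsub
  exact hsub (mem_closedBall_zero_iff.2 hu)

theorem isCompact_limitSet : IsCompact (limitSet L f) :=
  h.isCompact_hull.inter_right (isClosed_eq (continuous_form Q) continuous_const)

theorem scal_nonpos {g g' : E} (hg : g ∈ limitSet L f) (hg' : g' ∈ limitSet L f) :
    scal Q g g' ≤ 0 := by
  simpa [show Q g = 0 from hg.2] using h.scal_le_of_mem_hull hg.1 hg'.1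

theorem exists_scal_apply_neg {g : E} (hg : g ∈ limitSet L f) : ∃ s, scal Q g (f s) < 0 := by
  obtain ⟨s, hs⟩ := h.exists_scal_ne_zero g (h.ne_zero_of_mem_hull hg.1) hg.2
  exact ⟨s, (h.scal_apply_nonpos_of_mem_hull hg.1 s).lt_of_ne hs⟩

end IsAcausalGraph

end Hull

/-! ### The limit circle -/

section LimitCircle

open Set

/-- The standard isometry from the complex plane to the model plane. -/
def complexEquiv : ℂ ≃ₗᵢ[ℝ] ModelPlane := Complex.orthonormalBasisOneI.repr

variable {S G : Type*} [NormedAddCommGroup G] [NormedSpace ℝ G]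
  {L : E ≃L[ℝ] ModelPlane × G} {f : S → PseudoHyp Q}

namespace IsAcausalGraph

variable (h : IsAcausalGraph L f)

/-- The projection of the limit set to the unit circle of the positive definite plane. -/
def toCircle (g : limitSet L f) : Circle :=
  ⟨complexEquiv.symm (L (g : E)).1, by
    refine mem_sphere_zero_iff_norm.2 ?_
    rw [LinearIsometryEquiv.norm_map, h.norm_fst_of_mem_limitSet g.2]⟩

theorem complexEquiv_toCircle (g : limitSet L f) :
    complexEquiv (h.toCircle g : ℂ) = (L (g : E)).1 := complexEquiv.apply_symm_apply _

theorem continuous_toCircle : Continuous h.toCircle :=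
  (complexEquiv.symm.continuous.comp
    (continuous_fst.comp (L.continuous.comp continuous_subtype_val))).subtype_mk _

variable [FiniteDimensional ℝ E]

theorem bijective_toCircle : Function.Bijective h.toCircle := by
  refine ⟨fun g g' heq => Subtype.ext (h.injOn_hull g.2.1 g'.2.1 ?_), fun z => ?_⟩
  · change (L (g : E)).1 = (L (g' : E)).1
    rw [← h.complexEquiv_toCircle, heq, h.complexEquiv_toCircle]
  · have hz : ‖complexEquiv (z : ℂ)‖ = 1 := by rw [LinearIsometryEquiv.norm_map, Circle.norm_coe]
    obtain ⟨g, hg, hgz⟩ := h.exists_mem_hull hz.le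
    have hQ : Q g = 0 := by rw [h.form_of_mem_hull hg, hgz, hz, one_pow, sub_self]
    refine ⟨⟨g, hg, hQ⟩, Circle.ext (complexEquiv.injective ?_)⟩
    rw [h.complexEquiv_toCircle, hgz]

/-- The limit set is a topological circle. -/
def circleHomeo : limitSet L f ≃ₜ Circle :=
  haveI : CompactSpace (limitSet L f) := isCompact_iff_compactSpace.1 h.isCompact_limitSet
  Continuous.homeoOfEquivCompactToT2 (f := Equiv.ofBijective _ h.bijective_toCircle)
    h.continuous_toCircle

/-- The point of the limit set above a point of the circle. -/
def limitPoint (z : Circle) : E := h.circleHomeo.symm z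

theorem continuous_limitPoint : Continuous h.limitPoint :=
  continuous_subtype_val.comp h.circleHomeo.symm.continuous

theorem limitPoint_mem (z : Circle) : h.limitPoint z ∈ limitSet L f := (h.circleHomeo.symm z).2

theorem form_limitPoint (z : Circle) : Q (h.limitPoint z) = 0 := (h.limitPoint_mem z).2

theorem fst_limitPoint (z : Circle) : (L (h.limitPoint z)).1 = complexEquiv (z : ℂ) := by
  rw [limitPoint, ← h.complexEquiv_toCircle]
  exact congrArg (fun y : Circle => complexEquiv (y : ℂ)) (h.circleHomeo.apply_symm_apply z)

theorem scal_limitPoint_nonpos (z z' : Circle) :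
    scal Q (h.limitPoint z) (h.limitPoint z') ≤ 0 :=
  h.scal_nonpos (h.limitPoint_mem z) (h.limitPoint_mem z')

theorem scal_limitPoint_neg_lt_zero (z : Circle) :
    scal Q (h.limitPoint z) (h.limitPoint (-z)) < 0 := by
  refine (h.scal_limitPoint_nonpos z (-z)).lt_of_ne fun horth => ?_
  have hsum : h.limitPoint z + h.limitPoint (-z) = 0 := by
    refine h.isSplitting.eq_zero_of_fst_eq_zero ?_ (le_of_eq ?_)
    · rw [map_add, Prod.fst_add, fst_limitPoint, fst_limitPoint, ← map_add, Circle.coe_neg,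
        add_neg_cancel, map_zero]
    · rw [form_add, horth, form_limitPoint, form_limitPoint]
      ring
  obtain ⟨s, hs⟩ := h.exists_scal_apply_neg (h.limitPoint_mem z)
  have hnonpos := h.scal_apply_nonpos_of_mem_hull (h.limitPoint_mem (-z)).1 s
  rw [eq_neg_of_add_eq_zero_right hsum, map_neg, LinearMap.neg_apply] at hnonpos
  linarith

theorem eventually_scal_limitPoint_mul_neg :
    ∀ᶠ ζ in 𝓝 1, ∀ z, scal Q (h.limitPoint (z * ζ)) (h.limitPoint (-z)) < 0 := by
  have hcont : Continuous fun p : Circle × Circle =>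
      scal Q (h.limitPoint (p.2 * p.1)) (h.limitPoint (-p.2)) :=
    continuous_scal (h.continuous_limitPoint.comp (continuous_snd.mul continuous_fst))
      (h.continuous_limitPoint.comp continuous_snd.neg)
  have hev := isCompact_univ.eventually_forall_of_forall_eventually (x₀ := 1)
    (P := fun ζ z => scal Q (h.limitPoint (z * ζ)) (h.limitPoint (-z)) < 0) fun z _ =>
      hcont.continuousAt.eventually (gt_mem_nhds (by
        simpa only [mul_one] using h.scal_limitPoint_neg_lt_zero z))
  exact hev.mono fun ζ hζ z => hζ z (mem_univ z)

theorem limitPoint_mul_inv_add_limitPoint_mul {z ζ : Circle}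
    (h₁ : scal Q (h.limitPoint (z * ζ⁻¹)) (h.limitPoint z) = 0)
    (h₂ : scal Q (h.limitPoint z) (h.limitPoint (z * ζ)) = 0)
    (h₃ : scal Q (h.limitPoint (z * ζ⁻¹)) (h.limitPoint (z * ζ)) = 0) :
    h.limitPoint (z * ζ⁻¹) + h.limitPoint (z * ζ) = (2 * (ζ : ℂ).re) • h.limitPoint z := by
  refine sub_eq_zero.1 (h.isSplitting.eq_zero_of_fst_eq_zero ?_ (le_of_eq ?_))
  · have hre : ((z * ζ⁻¹ : Circle) : ℂ) + (z * ζ : Circle) = (2 * (ζ : ℂ).re) • (z : ℂ) := by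
      rw [Circle.coe_mul, Circle.coe_mul, Circle.coe_inv_eq_conj, ← mul_add, add_comm,
        Complex.add_conj, Complex.real_smul, mul_comm]
    rw [map_sub, map_add, map_smul, Prod.fst_sub, Prod.fst_add, Prod.smul_fst, fst_limitPoint,
      fst_limitPoint, fst_limitPoint, ← map_add, hre, map_smul, sub_self]
  · rw [scal_comm Q (h.limitPoint z)] at h₂
    simp only [form_sub, form_add, form_smul, form_limitPoint, map_add, map_smul,
      LinearMap.add_apply, smul_eq_mul, h₁, h₂, h₃]
    ring

theorem not_eventually_scal_limitPoint_eq_zero :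
    ¬ ∀ᶠ ζ in 𝓝 1, ∀ z, scal Q (h.limitPoint z) (h.limitPoint (z * ζ)) = 0 := by
  intro horth
  obtain ⟨s, hs⟩ := h.exists_scal_apply_neg (h.limitPoint_mem 1)
  have hsq : Filter.Tendsto (fun ζ : Circle => ζ * ζ) (𝓝 1) (𝓝 1) := by
    have hcont : Continuous fun ζ : Circle => ζ * ζ := continuous_id.mul continuous_id
    simpa only [mul_one] using hcont.tendsto 1
  have hzero := eq_zero_of_add_eq_re_mul (φ := fun z => -scal Q (h.limitPoint z) (f s))
    (continuous_scal h.continuous_limitPoint continuous_const).neg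
    (fun z => neg_nonneg.2 (h.scal_apply_nonpos_of_mem_hull (h.limitPoint_mem z).1 s)) ?_ 1
  · exact hs.ne (neg_eq_zero.1 hzero)
  · filter_upwards [horth, hsq.eventually horth] with ζ hζ hζζ z
    have hrec := h.limitPoint_mul_inv_add_limitPoint_mul (by simpa using hζ (z * ζ⁻¹)) (hζ z)
      (by simpa [mul_assoc] using hζζ (z * ζ⁻¹))
    rw [← neg_add, ← LinearMap.add_apply, ← map_add, hrec, map_smul, LinearMap.smul_apply,
      smul_eq_mul, mul_neg]

include h in
theorem exists_scal_neg_triple : ∃ a ∈ limitSet L f, ∃ b ∈ limitSet L f, ∃ c ∈ limitSet L f,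
    scal Q a b < 0 ∧ scal Q a c < 0 ∧ scal Q b c < 0 := by
  by_contra! hno
  refine h.not_eventually_scal_limitPoint_eq_zero ?_
  filter_upwards [h.eventually_scal_limitPoint_mul_neg] with ζ hζ z
  refine (h.scal_limitPoint_nonpos z (z * ζ)).antisymm (not_lt.1 fun hneg => ?_)
  exact (hζ z).not_ge (hno _ (h.limitPoint_mem z) _ (h.limitPoint_mem (z * ζ)) _
    (h.limitPoint_mem (-z)) hneg (h.scal_limitPoint_neg_lt_zero z))

end IsAcausalGraph

end LimitCircle

/-! ### The asymptotic boundary -/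

section Boundary

open Set

namespace IsAcausalGraph

section Rays

variable {S F G : Type*} [NormedAddCommGroup F] [NormedSpace ℝ F] [NormedAddCommGroup G]
  [NormedSpace ℝ G] {L : E ≃L[ℝ] F × G} {f : S → PseudoHyp Q} (h : IsAcausalGraph L f)

/-- The ray spanned by a point of the hull. -/
def hullRay (g : hull L f) : Module.Ray ℝ E := rayOfNeZero ℝ (g : E) (h.ne_zero_of_mem_hull g.2)

theorem continuous_hullRay : Continuous h.hullRay :=
  continuous_rayOfNeZero.comp
    (continuous_subtype_val.subtype_mk fun g : hull L f => h.ne_zero_of_mem_hull g.2)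

theorem hullRay_injective : Function.Injective h.hullRay := by
  intro g g' heq
  obtain ⟨c, hc, hcg⟩ := exists_pos_smul_eq_of_rayOfNeZero_eq heq
  have hnorm := h.norm_snd_of_mem_hull g'.2
  rw [← hcg, map_smul, Prod.smul_snd, norm_smul, h.norm_snd_of_mem_hull g.2, mul_one,
    Real.norm_of_nonneg hc.le] at hnorm
  rw [hnorm, one_smul] at hcg
  exact Subtype.ext hcg

theorem hullRay_unitPoint (s : S) :
    h.hullRay ⟨unitPoint L f s, unitPoint_mem_hull s⟩ = toRay Q (f s) := by
  rw [hullRay, toRay, ray_eq_iff]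
  exact SameRay.sameRay_pos_smul_left _ (inv_pos.2 (h.norm_snd_pos s))

/-- The ray spanned by a point of the limit set. -/
def limitRay (g : limitSet L f) : Module.Ray ℝ E := h.hullRay ⟨g, g.2.1⟩

theorem continuous_limitRay : Continuous h.limitRay :=
  h.continuous_hullRay.comp (continuous_subtype_val.subtype_mk _)

theorem limitRay_injective : Function.Injective h.limitRay := fun _ _ heq =>
  Subtype.ext (Subtype.mk.inj (h.hullRay_injective heq))

theorem raySpan_limitRay (a b c : limitSet L f) :
    raySpan {h.limitRay a, h.limitRay b, h.limitRay c} =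
      Submodule.span ℝ {(a : E), (b : E), (c : E)} := by
  simpa only [limitRay, hullRay, image_insert_eq, image_singleton] using raySpan_image
    (fun g : limitSet L f => (g : E)) (fun g => h.ne_zero_of_mem_hull g.2.1) {a, b, c}

variable [FiniteDimensional ℝ E]

theorem closure_image_toRay : closure (toRay Q '' range f) = range h.hullRay := by
  apply Subset.antisymm
  · have : CompactSpace (hull L f) := isCompact_iff_compactSpace.1 h.isCompact_hull
    refine closure_minimal ?_ (isCompact_range h.continuous_hullRay).isClosed
    rintro _ ⟨_, ⟨s, rfl⟩, rfl⟩
    exact ⟨_, h.hullRay_unitPoint s⟩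
  · rintro _ ⟨g, rfl⟩
    have hsub : range (unitPoint L f) ⊆ hull L f := subset_closure
    have hg : g ∈ closure (Subtype.val ⁻¹' range (unitPoint L f)) := by
      rw [closure_subtype, Subtype.image_preimage_coe, inter_eq_right.2 hsub]
      exact g.2
    refine map_mem_closure h.continuous_hullRay hg ?_
    rintro ⟨_, -⟩ ⟨s, rfl⟩
    exact ⟨f s, mem_range_self s, (h.hullRay_unitPoint s).symm⟩

theorem asymptoticBoundary_eq : asymptoticBoundary Q (range f) = range h.limitRay := by
  rw [asymptoticBoundary, totalBoundary, h.closure_image_toRay]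
  apply Subset.antisymm
  · rintro _ ⟨⟨⟨⟨g, rfl⟩, -⟩, -⟩, hinf⟩
    exact ⟨⟨g, g.2, (rayOfNeZero_mem_infinity_iff _).1 hinf⟩, rfl⟩
  · rintro _ ⟨g, rfl⟩
    have hinf : h.limitRay g ∈ infinity Q := (rayOfNeZero_mem_infinity_iff _).2 g.2.2
    refine ⟨⟨⟨mem_range_self _, Or.inr hinf⟩, ?_⟩, hinf⟩
    rintro ⟨x, -, hx⟩
    exact toRay_notMem_infinity x (hx ▸ hinf)

theorem not_isNegativeTriple_limitRay (a b c : limitSet L f) :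
    ¬ IsNegativeTriple Q (h.limitRay a) (h.limitRay b) (h.limitRay c) := by
  rintro ⟨-, -, -, hsig⟩
  rw [raySpan_limitRay] at hsig
  exact not_hasSignature_one_two a.2.2 b.2.2 c.2.2 (h.scal_nonpos a.2 b.2)
    (h.scal_nonpos a.2 c.2) (h.scal_nonpos b.2 c.2) hsig

theorem isPositiveTriple_limitRay {a b c : limitSet L f} (hab : scal Q (a : E) b < 0)
    (hac : scal Q (a : E) c < 0) (hbc : scal Q (b : E) c < 0) :
    IsPositiveTriple Q (h.limitRay a) (h.limitRay b) (h.limitRay c) := by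
  have hne {x y : limitSet L f} (hxy : scal Q (x : E) y < 0) : h.limitRay x ≠ h.limitRay y := by
    intro heq
    rw [h.limitRay_injective heq, scal_self, show Q (y : E) = 0 from y.2.2] at hxy
    exact lt_irrefl _ hxy
  refine ⟨hne hab, hne hac, hne hbc, ?_⟩
  rw [raySpan_limitRay]
  exact hasSignature_two_one a.2.2 b.2.2 c.2.2 hab hac hbc

end Rays

variable [FiniteDimensional ℝ E] {S G : Type*} [NormedAddCommGroup G] [NormedSpace ℝ G]
  {L : E ≃L[ℝ] ModelPlane × G} {f : S → PseudoHyp Q} (h : IsAcausalGraph L f)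

/-- The asymptotic boundary is a topological circle, through the rays of the limit set. -/
def asymptoticBoundaryHomeo : asymptoticBoundary Q (range f) ≃ₜ Circle :=
  haveI : CompactSpace (limitSet L f) := isCompact_iff_compactSpace.1 h.isCompact_limitSet
  (Homeomorph.setCongr h.asymptoticBoundary_eq).trans <|
    (Continuous.homeoOfEquivCompactToT2 (f := Equiv.ofInjective _ h.limitRay_injective)
      (h.continuous_limitRay.subtype_mk _)).symm.trans h.circleHomeo

include h

theorem isSemiPositiveLoop : IsSemiPositiveLoop Q (asymptoticBoundary Q (range f)) := by
  refine ⟨fun r hr => Or.inr hr.2, ⟨h.asymptoticBoundaryHomeo⟩, ?_, ?_⟩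
  · rw [h.asymptoticBoundary_eq]
    rintro ⟨_, ⟨a, rfl⟩, _, ⟨b, rfl⟩, _, ⟨c, rfl⟩, hneg⟩
    exact h.not_isNegativeTriple_limitRay a b c hneg
  · rw [h.asymptoticBoundary_eq]
    obtain ⟨a, ha, b, hb, c, hc, hab, hac, hbc⟩ := h.exists_scal_neg_triple
    exact ⟨_, ⟨⟨a, ha⟩, rfl⟩, _, ⟨⟨b, hb⟩, rfl⟩, _, ⟨⟨c, hc⟩, rfl⟩,
      h.isPositiveTriple_limitRay hab hac hbc⟩

end IsAcausalGraph

variable [FiniteDimensional ℝ E] {S : Type*} [TopologicalSpace S]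
  [ChartedSpace (EuclideanSpace ℝ (Fin 2)) S] {f : S → PseudoHyp Q}

theorem IsEntireGraph.exists_projU_eq (h : IsEntireGraph Q f) (P : PointedPlane Q) {u : E}
    (hu : u ∈ P.U) : ∃ s, P.projU (f s) = u := by
  obtain ⟨-, -, ψ, -, -, hψ⟩ := h P
  refine ⟨ψ (u + √(1 + Q u) • P.q), ?_⟩
  have hproj := congrArg P.projU (hψ _ (P.mem_plane_iff.2 ⟨u, hu, rfl⟩))
  rwa [P.projU_warpedProj, map_add, map_smul, P.projU_q, smul_zero, add_zero,
    P.projU_of_mem_U hu] at hproj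

theorem IsEntireGraph.exists_isAcausalGraph [IsManifold (𝓡 2) ∞ S] [ConnectedSpace S] {m : ℕ}
    (hQ : HasSignature Q ⊤ 2 m) (hf : IsSpacelikeImmersion Q f) (h : IsEntireGraph Q f) :
    ∃ L : E ≃L[ℝ] ModelPlane × EuclideanSpace ℝ (Fin m), IsAcausalGraph L f := by
  obtain ⟨s₀⟩ : Nonempty S := inferInstance
  obtain ⟨p⟩ := hf.exists_localParam s₀
  obtain ⟨L, hL, hP⟩ := p.tangentPlane.exists_isSplitting hQ
  refine ⟨L, hL, h.projInjective.scal_le hf, fun v => ?_, fun g hg hQg => ?_⟩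
  · have hv : L.symm (v, 0) ∈ p.tangentPlane.U := by
      simpa only [hP, L.apply_symm_apply] using p.tangentPlane.projU_mem (L.symm (v, 0))
    obtain ⟨s, hs⟩ := h.exists_projU_eq p.tangentPlane hv
    rw [hP] at hs
    exact ⟨s, congrArg Prod.fst (L.symm.injective hs)⟩
  · by_contra! hall
    have hext : IsLocalExtr (fun t => scalL Q g (f t)) s₀ :=
      Or.inl (Filter.Eventually.of_forall fun t => by simp only [scalL_apply, hall, le_refl])
    have hW : g ∈ p.tangentPlane.W := p.mem_tangentPlane_W
      (p.apply_deriv_eq_zero_of_isLocalExtr (scalL Q g).hasFDerivAt hext)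
    exact (p.tangentPlane.neg_of_mem_W hQ hW hg).ne hQg

end Boundary

end PseudoHyperbolic

end

theorem propositionp_general
    {E : Type*} [NormedAddCommGroup E] [NormedSpace ℝ E] [FiniteDimensional ℝ E]
    {m : ℕ} (Q : QuadraticForm ℝ E)
    (hQ : PseudoHyperbolic.HasSignature Q ⊤ 2 m)
    {S : Type*} [TopologicalSpace S] [T2Space S] [ConnectedSpace S]
    [ChartedSpace (EuclideanSpace ℝ (Fin 2)) S] [IsManifold (𝓡 2) ∞ S]
    (f : S → PseudoHyperbolic.PseudoHyp Q)
    (hf : PseudoHyperbolic.IsSpacelikeImmersion Q f) :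
    (IsProperMap f ∨ PseudoHyperbolic.IsCompleteInduced Q f →
      PseudoHyperbolic.IsEntireGraph Q f) ∧
    (PseudoHyperbolic.IsEntireGraph Q f →
      PseudoHyperbolic.IsAcausalSet Q (Set.range f)) ∧
    (PseudoHyperbolic.IsEntireGraph Q f →
      ∀ A : Set (PseudoHyperbolic.PseudoHyp Q),
        PseudoHyperbolic.IsTimelikeSphere Q A → ∃! s : S, f s ∈ A) ∧
    (PseudoHyperbolic.IsEntireGraph Q f →
      PseudoHyperbolic.IsSemiPositiveLoop Q
        (PseudoHyperbolic.asymptoticBoundary Q (Set.range f))) := by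
  refine ⟨fun h => hf.isEntireGraph hQ h, fun h => h.projInjective.isAcausalSet hf,
    fun h A hA => h.existsUnique_mem hA, fun h => ?_⟩
  obtain ⟨L, hL⟩ := h.exists_isAcausalGraph hQ hf
  exact hL.isSemiPositiveLoop

theorem propositionp
    {E : Type*} [NormedAddCommGroup E] [NormedSpace ℝ E] [FiniteDimensional ℝ E]
    (n : ℕ) (Q : QuadraticForm ℝ E)
    (hQ : PseudoHyperbolic.HasSignature Q ⊤ 2 (n + 1))
    {S : Type*} [TopologicalSpace S] [T2Space S] [SecondCountableTopology S]
    [ChartedSpace (EuclideanSpace ℝ (Fin 2)) S] [IsManifold (𝓡 2) ∞ S]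
    [SimplyConnectedSpace S]
    (f : S → PseudoHyperbolic.PseudoHyp Q)
    (hf : PseudoHyperbolic.IsSpacelikeImmersion Q f) :
    (IsProperMap f ∨ PseudoHyperbolic.IsCompleteInduced Q f →
      PseudoHyperbolic.IsEntireGraph Q f) ∧
    (PseudoHyperbolic.IsEntireGraph Q f →
      PseudoHyperbolic.IsAcausalSet Q (Set.range f)) ∧
    (PseudoHyperbolic.IsEntireGraph Q f →
      ∀ A : Set (PseudoHyperbolic.PseudoHyp Q),
        PseudoHyperbolic.IsTimelikeSphere Q A → ∃! s : S, f s ∈ A) ∧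
    (PseudoHyperbolic.IsEntireGraph Q f →
      PseudoHyperbolic.IsSemiPositiveLoop Q
        (PseudoHyperbolic.asymptoticBoundary Q (Set.range f))) :=
  propositionp_general Q hQ f hf
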